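/- Let $r\ge 3$ and $0\le s\le r$, and let $G^M$ be the graph with vertex set $U\cup V$, $U=\{u_1,\dots,u_r\}$, $V=\{v_1,\dots,v_s\}$, and edge set $E_u\cup E_{uv}$, where $E_u=\{e_i=(u_i,u_{i+1}):1\le i\le r\}$ (with $u_{r+1}=u_1$) and $E_{uv}=\{(u_i,v_j):1\le i\le r,\ 1\le j\le s\}$. An MEE-tour (matching edge ejection tour) is a Hamiltonian cycle of $G^M$ obtained by choosing distinct indices $\pi(1),\dots,\pi(s)\in\{1,\dots,r\}$, deleting the edges $e_{\pi(1)},\dots,e_{\pi(s)}$ from the cycle $E_u$, and joining each $v_j$ to both end points of $e_{\pi(j)}$; let $F(\mathrm{MEE})$ be the set of all MEE-tours, viewed as sets of edges. The problem QTSP(1,H)-MEE is, given $r$, $s$ and rational edge costs $a_e,b_e$ $(e\in E_u\cup E_{uv})$, to minimize $$q(\tau)=\Bigl(\sum_{e\in\tau}a_e\Bigr)\Bigl(\sum_{e\in\tau}b_e\Bigr)\quad\text{over }\tau\in F(\mathrm{MEE}).$$ **Corollary.** QTSP(1,H)-MEE with nonnegative costs $a,b\ge 0$ admits a fully polynomial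 time approximation scheme (FPTAS): there is an algorithm (a single program of a random access machine with logarithmic cost, which receives the instance together with the accuracy parameter $\lceil 1/\varepsilon\rceil$) that, for every such instance $I$ and every real $\varepsilon>0$, outputs a tour $\tau\in F(\mathrm{MEE})$ with $q(\tau)\le(1+\varepsilon)\,q(\tau')$ for all $\tau'\in F(\mathrm{MEE})$, in time bounded by a fixed polynomial in the binary encoding length of $I$ and $1/\varepsilon$. -/

import Mathlib

/-! ## A random access machine with logarithmic cost

A memory consists of banks `M 0, M 1, …`, each an array of natural numbers indexed by `ℕ`. A program
mentions finitely many banks, cells are addressed by computed values, and every operation is charged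
the binary lengths of all the numbers (addresses, operands, results) it handles. -/

namespace RAM

/-- Memory: `M x i` is the content of cell `i` of bank `x`. -/
abbrev Mem : Type := ℕ → ℕ → ℕ

/-- Arithmetic operations; `sub` is truncated at `0`, `div` rounds down (with `n / 0 = 0`). -/
inductive Op where
  | add | sub | mul | div

def Op.eval : Op → ℕ → ℕ → ℕ
  | .add, m, n => m + n
  | .sub, m, n => m - n
  | .mul, m, n => m * n
  | .div, m, n => m / n

/-- Expressions: constants, the cell of bank `x` at a computed address, arithmetic. -/
inductive Expr where
  | lit (n : ℕ)
  | get (x : ℕ) (i : Expr)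
  | bin (o : Op) (e₁ e₂ : Expr)

def Expr.eval (M : Mem) : Expr → ℕ
  | .lit n => n
  | .get x i => M x (i.eval M)
  | .bin o e₁ e₂ => o.eval (e₁.eval M) (e₂.eval M)

/-- Logarithmic cost of evaluating an expression; `Nat.size` is the binary length. -/
def Expr.cost (M : Mem) : Expr → ℕ
  | .lit n => Nat.size n + 1
  | .get x i => i.cost M + Nat.size (i.eval M) + Nat.size (M x (i.eval M)) + 1
  | .bin o e₁ e₂ => e₁.cost M + e₂.cost M + Nat.size (e₁.eval M) + Nat.size (e₂.eval M)
      + Nat.size (o.eval (e₁.eval M) (e₂.eval M)) + 1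

/-- Programs. Conditions hold when their value is nonzero. -/
inductive Cmd where
  | skip
  | set (x : ℕ) (i e : Expr)
  | seq (c₁ c₂ : Cmd)
  | ite (e : Expr) (c₁ c₂ : Cmd)
  | loop (e : Expr) (c : Cmd)

/-- The memory after writing `v` to cell `i` of bank `x`. -/
def Mem.write (M : Mem) (x i v : ℕ) : Mem :=
  fun y j => if y = x ∧ j = i then v else M y j

/-- `Exec c M t M'`: program `c`, started in memory `M`, halts in memory `M'` at total cost `t`. -/
inductive Exec : Cmd → Mem → ℕ → Mem → Prop where
  | skip (M : Mem) : Exec .skip M 1 M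
  | set (M : Mem) (x : ℕ) (i e : Expr) :
      Exec (.set x i e) M
        (i.cost M + e.cost M + Nat.size (i.eval M) + Nat.size (e.eval M) + 1)
        (M.write x (i.eval M) (e.eval M))
  | seq {c₁ c₂ : Cmd} {M M' M'' : Mem} {t₁ t₂ : ℕ}
      (h₁ : Exec c₁ M t₁ M') (h₂ : Exec c₂ M' t₂ M'') :
      Exec (.seq c₁ c₂) M (t₁ + t₂) M''
  | ite_true {e : Expr} {c₁ c₂ : Cmd} {M M' : Mem} {t : ℕ}
      (he : e.eval M ≠ 0) (h : Exec c₁ M t M') :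
      Exec (.ite e c₁ c₂) M (e.cost M + 1 + t) M'
  | ite_false {e : Expr} {c₁ c₂ : Cmd} {M M' : Mem} {t : ℕ}
      (he : e.eval M = 0) (h : Exec c₂ M t M') :
      Exec (.ite e c₁ c₂) M (e.cost M + 1 + t) M'
  | loop_done {e : Expr} {c : Cmd} {M : Mem} (he : e.eval M = 0) :
      Exec (.loop e c) M (e.cost M + 1) M
  | loop_step {e : Expr} {c : Cmd} {M M' M'' : Mem} {t₁ t₂ : ℕ}
      (he : e.eval M ≠ 0) (h₁ : Exec c M t₁ M') (h₂ : Exec (.loop e c) M' t₂ M'') :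
      Exec (.loop e c) M (e.cost M + 1 + t₁ + t₂) M''

/-- Initial memory: the input words are in bank `0`, every other cell is `0`. -/
def initMem (w : List ℕ) : Mem :=
  fun x i => if x = 0 then w.getD i 0 else 0

/-- The output is read from bank `1`: cell `0` holds its length, cells `1, 2, …` its entries. -/
def output (M : Mem) : List ℕ :=
  (List.range (M 1 0)).map fun i => M 1 (i + 1)

/-- Number of symbols needed to write a list of natural numbers in binary, with separators. -/
def wordSize (w : List ℕ) : ℕ :=
  (w.map fun n => Nat.size n + 1).sum

end RAM

/-! ## Minimization problems and fully polynomial time approximation schemes -/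

/-- A minimization problem: instances, feasible solutions, objective values, the encoding of
instances as words, and which output words describe which solution. -/
structure MinProblem where
  Inst : Type
  Sol : Inst → Type
  value : (I : Inst) → Sol I → ℚ
  encode : Inst → List ℕ
  Describes : (I : Inst) → List ℕ → Sol I → Prop

/-- Fully polynomial time approximation scheme: a single program that, for every instance `I` and
every `ε > 0`, outputs a feasible solution of value at most `(1 + ε)` times that of every feasible
solution, in time polynomial in the binary size of `I` and in `1 / ε`. A real number cannot be an
input; the program gets the required accuracy as the natural number `⌈1 / ε⌉`. -/
def MinProblem.AdmitsFPTAS (P : MinProblem) : Prop :=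
  ∃ (c : RAM.Cmd) (C d : ℕ), ∀ (I : P.Inst) (ε : ℝ), 0 < ε →
    ∃ (t : ℕ) (M : RAM.Mem),
      RAM.Exec c (RAM.initMem (⌈1 / ε⌉₊ :: P.encode I)) t M ∧
      (t : ℝ) ≤ C * ((RAM.wordSize (P.encode I) : ℝ) + 1 / ε) ^ d ∧
      ∃ S : P.Sol I, P.Describes I (RAM.output M) S ∧
        ∀ S' : P.Sol I, (P.value I S : ℝ) ≤ (1 + ε) * (P.value I S' : ℝ)

/-! ## Matching edge ejection tours -/

namespace MEE

/-- Vertices `U ∪ V`: `Sum.inl i` is `u_i` and `Sum.inr j` is `v_j`. -/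
abbrev Vert (r s : ℕ) : Type := Fin r ⊕ Fin s

/-- The edge `e_i = (u_i, u_{i+1})`, indices modulo `r`. -/
def cycEdge (r s : ℕ) (i : Fin r) : Sym2 (Vert r s) :=
  s(Sum.inl i, Sum.inl (finRotate r i))

/-- The edge `(u_i, v_j)`. -/
def crossEdge {r s : ℕ} (i : Fin r) (j : Fin s) : Sym2 (Vert r s) :=
  s(Sum.inl i, Sum.inr j)

/-- The graph `G^M`, with edge set `E_u ∪ E_uv`. -/
def graph (r s : ℕ) : SimpleGraph (Vert r s) :=
  SimpleGraph.fromEdgeSet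
    (Set.range (cycEdge r s) ∪ {e | ∃ (i : Fin r) (j : Fin s), e = crossEdge i j})

/-- The edges left and created when `e_{π(1)}, …, e_{π(s)}` are ejected from the cycle `E_u` and
each `v_j` is joined to the two end points of `e_{π(j)}`. -/
def ejectInsert {r s : ℕ} (π : Fin s ↪ Fin r) : Finset (Sym2 (Vert r s)) :=
  (Finset.univ.image (cycEdge r s) \ Finset.univ.image fun j => cycEdge r s (π j)) ∪
    Finset.univ.biUnion fun j => {crossEdge (π j) j, crossEdge (finRotate r (π j)) j}

/-- `F(MEE)`: the tours (edge sets of Hamiltonian cycles) of `G^M` obtained by ejecting `s` edges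
of the cycle `E_u` and inserting the vertices of `V` in their places. -/
def tours (r s : ℕ) : Set (Finset (Sym2 (Vert r s))) :=
  {τ | (∃ (u : Vert r s) (p : (graph r s).Walk u u),
          p.IsHamiltonianCycle ∧ p.edges.toFinset = τ) ∧
        ∃ π : Fin s ↪ Fin r, τ = ejectInsert π}

/-- An instance of the homogeneous rank 1 problem: a graph `G^M` (the cycle `E_u` has at least
three vertices, and `s ≤ r`) with nonnegative rational edge costs `a` and `b`. The values of `a`
and `b` off the edge set are irrelevant. -/
structure Instance where
  r : ℕ
  s : ℕ
  three_le : 3 ≤ r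
  s_le_r : s ≤ r
  a : Sym2 (Vert r s) → ℚ
  b : Sym2 (Vert r s) → ℚ
  a_nonneg : ∀ e ∈ (graph r s).edgeSet, 0 ≤ a e
  b_nonneg : ∀ e ∈ (graph r s).edgeSet, 0 ≤ b e

/-- The objective `q(τ) = (∑_{e ∈ τ} a_e) (∑_{e ∈ τ} b_e)`. -/
def Instance.objective (I : Instance) (τ : Finset (Sym2 (Vert I.r I.s))) : ℚ :=
  (∑ e ∈ τ, I.a e) * (∑ e ∈ τ, I.b e)

/-- The costs of an edge as four words: numerators and denominators of `a_e` and `b_e`. -/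
def Instance.edgeWords (I : Instance) (e : Sym2 (Vert I.r I.s)) : List ℕ :=
  [(I.a e).num.toNat, (I.a e).den, (I.b e).num.toNat, (I.b e).den]

/-- An instance as a list of words: `r`, `s`, the costs of `e_1, …, e_r`, then those of the edges
`(u_i, v_j)` in lexicographic order. -/
def Instance.encode (I : Instance) : List ℕ :=
  I.r :: I.s ::
    ((List.finRange I.r).flatMap (fun i => I.edgeWords (cycEdge I.r I.s i)) ++
      (List.finRange I.r).flatMap fun i =>
        (List.finRange I.s).flatMap fun j => I.edgeWords (crossEdge i j))

/-- Vertex numbers: the `u_i` get `0, …, r - 1`, the `v_j` get `r, …, r + s - 1`. -/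
def vertNum {r s : ℕ} : Vert r s → ℕ
  | Sum.inl i => i
  | Sum.inr j => r + j

/-- A list of words describes a tour if it lists the numbers of the vertices in the order in which
some Hamiltonian cycle with this edge set visits them. -/
def Describes {r s : ℕ} (w : List ℕ) (τ : Finset (Sym2 (Vert r s))) : Prop :=
  ∃ (u : Vert r s) (p : (graph r s).Walk u u),
    p.IsHamiltonianCycle ∧ p.edges.toFinset = τ ∧ w = p.support.tail.map vertNum

end MEE

/-- QTSP(1,H)-MEE with nonnegative costs. -/
def qtspRankOneMEE : MinProblem where
  Inst := MEE.Instance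
  Sol I := MEE.tours I.r I.s
  value I τ := I.objective τ.1
  encode I := I.encode
  Describes _ w τ := MEE.Describes w τ.1

/-! Giving each edge `e_i` either the vertex inserted into it or a placeholder for keeping it turns
the tours into the assignments of `r` persons to `r` objects, and each of the two factors of the
objective into the total cost of an assignment. Suppose that the two factors `A`, `B` of an
optimal tour were known. By the inequality of arithmetic and geometric means, an assignment that
nearly minimizes the linear cost `x / A + y / B` nearly minimizes the product, since
`4 x y / (A B) ≤ (x / A + y / B) ^ 2` with equality at the optimum. So it suffices to solve linear
assignment problems for all pairs of guesses for `A` and `B` on a geometric grid of ratio about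
`1 + ε`, which has polynomially many points below the largest possible cost.

The linear weights are rounded and capped to integers of size polynomial in `r` and `1 / ε`. This
makes the auction algorithm polynomial: every bid raises a price by one, no price exceeds the
largest weight by more than one, and complementary slackness up to one unit per object loses at
most `r` in total. -/

/-! ## Reasoning about programs -/

namespace RAM

theorem Op.size_eval_le (o : Op) (m n : ℕ) : (o.eval m n).size ≤ m.size + n.size + 1 := by
  have hm := Nat.lt_size_self m
  have hn := Nat.lt_size_self n
  cases o with
  | add =>
    have hm' : 2 ^ m.size ≤ 2 ^ (m.size + n.size) := Nat.pow_le_pow_right two_pos (by omega)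
    have hn' : 2 ^ n.size ≤ 2 ^ (m.size + n.size) := Nat.pow_le_pow_right two_pos (by omega)
    refine Nat.size_le.2 ?_
    simp only [Op.eval, pow_succ]
    omega
  | sub => exact (Nat.size_le_size (Nat.sub_le m n)).trans (by omega)
  | mul =>
    have hmn : m * n < 2 ^ (m.size + n.size) := pow_add 2 m.size n.size ▸ Nat.mul_lt_mul'' hm hn
    exact (Nat.size_le.2 hmn).trans (by omega)
  | div => exact (Nat.size_le_size (Nat.div_le_self m n)).trans (by omega)

/-- All cells hold numbers of at most `b` bits. -/
def Bounded (b : ℕ) (M : Mem) : Prop := ∀ x i, M x i < 2 ^ b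

/-- A bound, independent of the memory, for the cost of an expression in units of the word length
of the memory plus one. -/
def Expr.weight : Expr → ℕ
  | .lit n => 2 * n + 1
  | .get _ i => i.weight + 2
  | .bin _ e f => 3 * (e.weight + f.weight) + 3

theorem Expr.cost_add_size_le {b : ℕ} {M : Mem} (hM : Bounded b M) (e : Expr) :
    e.cost M + (e.eval M).size ≤ e.weight * (b + 1) := by
  induction e with
  | lit n =>
    have hn : n.size ≤ n := Nat.size_le.2 Nat.lt_two_pow_self
    simp only [Expr.cost, Expr.eval, Expr.weight]
    nlinarith
  | get x i ih =>
    have hcell := Nat.size_le.2 (hM x (i.eval M))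
    simp only [Expr.cost, Expr.eval, Expr.weight]
    nlinarith
  | bin o e f he hf =>
    have hop := o.size_eval_le (e.eval M) (f.eval M)
    simp only [Expr.cost, Expr.eval, Expr.weight]
    nlinarith

/-- The largest weight of an elementary step of a program. -/
def Cmd.weight : Cmd → ℕ
  | .skip => 1
  | .set _ i e => i.weight + e.weight + 1
  | .seq c d => max c.weight d.weight
  | .ite e c d => max (e.weight + 1) (max c.weight d.weight)
  | .loop e c => max (e.weight + 1) c.weight

theorem Expr.cost_add_one_le {b w : ℕ} {M : Mem} (hM : Bounded b M) (e : Expr)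
    (hw : e.weight + 1 ≤ w) : e.cost M + 1 ≤ w * (b + 1) := by
  have hcost := e.cost_add_size_le hM
  have hmul := Nat.mul_le_mul_right (b + 1) hw
  nlinarith

/-- The banks a program may write to. -/
def Cmd.writes : Cmd → List ℕ
  | .skip => []
  | .set x _ _ => [x]
  | .seq c d => c.writes ++ d.writes
  | .ite _ c d => c.writes ++ d.writes
  | .loop _ c => c.writes

/-- Two memories differ at most in the banks listed in `xs`. -/
def AgreeOff (xs : List ℕ) (M M' : Mem) : Prop := ∀ x ∉ xs, M' x = M x

namespace AgreeOff

variable {xs ys : List ℕ} {M M' M'' : Mem}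

theorem refl (xs : List ℕ) (M : Mem) : AgreeOff xs M M := fun _ _ => rfl

theorem trans (h : AgreeOff xs M M') (h' : AgreeOff xs M' M'') : AgreeOff xs M M'' :=
  fun x hx => (h' x hx).trans (h x hx)

theorem mono (h : AgreeOff xs M M') (hsub : xs ⊆ ys) : AgreeOff ys M M' :=
  fun x hx => h x fun hmem => hx (hsub hmem)

end AgreeOff

namespace Mem

variable (M : Mem)

theorem write_apply (x i v y j : ℕ) :
    M.write x i v y j = if y = x ∧ j = i then v else M y j := rfl

theorem write_bank (x i v : ℕ) : M.write x i v x = Function.update (M x) i v := by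
  funext j
  simp [write, Function.update_apply]

theorem write_of_ne {x y : ℕ} (i v : ℕ) (h : y ≠ x) : M.write x i v y = M y := by
  funext j
  simp [write, h]

@[simp] theorem write_self (x i v : ℕ) : M.write x i v x i = v := by simp [write]

theorem agreeOff_write (x i v : ℕ) : AgreeOff [x] M (M.write x i v) :=
  fun _ hy => M.write_of_ne i v (List.ne_of_not_mem_cons hy)

end Mem

theorem AgreeOff.of_write {xs : List ℕ} {M M' : Mem} {x i v : ℕ}
    (h : AgreeOff xs (M.write x i v) M') : AgreeOff (x :: xs) M M' :=
  ((M.agreeOff_write x i v).mono (by simp)).trans (h.mono (List.subset_cons_self x xs))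

theorem Exec.agreeOff {c : Cmd} {M M' : Mem} {t : ℕ} (h : Exec c M t M') :
    AgreeOff c.writes M M' := by
  induction h with
  | skip M => exact .refl _ M
  | set M x i e => exact M.agreeOff_write x _ _
  | seq _ _ ih₁ ih₂ =>
    exact (ih₁.mono (List.subset_append_left _ _)).trans (ih₂.mono (List.subset_append_right _ _))
  | ite_true _ _ ih => exact ih.mono (List.subset_append_left _ _)
  | ite_false _ _ ih => exact ih.mono (List.subset_append_right _ _)
  | loop_done _ => exact .refl _ _
  | loop_step _ _ _ ih₁ ih₂ => exact ih₁.trans ih₂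

/-- `Runs b c M T Q`: in a memory of `b`-bit words, `c` halts after at most `T` elementary steps,
never writes a longer word, and ends in a memory satisfying `Q`. -/
def Runs (b : ℕ) (c : Cmd) (M : Mem) (T : ℕ) (Q : Mem → Prop) : Prop :=
  Bounded b M → ∃ t M', Exec c M t M' ∧ t ≤ T * (c.weight * (b + 1)) ∧ Bounded b M' ∧ Q M'

namespace Runs

variable {b x T T₁ T₂ : ℕ} {c d : Cmd} {e i : Expr} {M : Mem} {P Q : Mem → Prop}

theorem mono (h : Runs b c M T₁ P) (hT : T₁ ≤ T₂) (hPQ : ∀ M', P M' → Q M') :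
    Runs b c M T₂ Q := by
  intro hM
  obtain ⟨t, M', hexec, ht, hM', hP⟩ := h hM
  exact ⟨t, M', hexec, ht.trans (Nat.mul_le_mul_right _ hT), hM', hPQ M' hP⟩

theorem framed (h : Runs b c M T Q) :
    Runs b c M T (fun M' => AgreeOff c.writes M M' ∧ Q M') := by
  intro hM
  obtain ⟨t, M', hexec, ht, hM', hQ⟩ := h hM
  exact ⟨t, M', hexec, ht, hM', hexec.agreeOff, hQ⟩

theorem skip (h : Q M) : Runs b .skip M 1 Q := by
  refine fun hM => ⟨1, M, .skip M, ?_, hM, h⟩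
  simp [Cmd.weight]

theorem set (he : e.eval M < 2 ^ b) (h : Q (M.write x (i.eval M) (e.eval M))) :
    Runs b (.set x i e) M 1 Q := by
  refine fun hM => ⟨_, _, .set M x i e, ?_, fun y j => ?_, h⟩
  · have hi := i.cost_add_size_le hM
    have he := e.cost_add_size_le hM
    simp only [Cmd.weight]
    nlinarith
  · rw [Mem.write_apply]
    split_ifs
    exacts [he, hM y j]

theorem seq (h₁ : Runs b c M T₁ P) (h₂ : ∀ M', P M' → Runs b d M' T₂ Q) :
    Runs b (.seq c d) M (T₁ + T₂) Q := by
  intro hM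
  obtain ⟨t₁, M', hexec₁, ht₁, hM', hP⟩ := h₁ hM
  obtain ⟨t₂, M'', hexec₂, ht₂, hM'', hQ⟩ := h₂ M' hP hM'
  refine ⟨t₁ + t₂, M'', .seq hexec₁ hexec₂, ?_, hM'', hQ⟩
  rw [add_mul]
  gcongr
  · exact ht₁.trans (by gcongr; exact le_max_left _ _)
  · exact ht₂.trans (by gcongr; exact le_max_right _ _)

theorem set_seq (he : e.eval M < 2 ^ b)
    (h : Runs b c (M.write x (i.eval M) (e.eval M)) T Q) :
    Runs b (.seq (.set x i e) c) M (1 + T) Q :=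
  seq (P := (· = M.write x (i.eval M) (e.eval M))) (set he rfl) fun _ hM' => hM' ▸ h

theorem ite (h₁ : e.eval M ≠ 0 → Runs b c M T Q) (h₂ : e.eval M = 0 → Runs b d M T Q) :
    Runs b (.ite e c d) M (T + 1) Q := by
  intro hM
  have htest := e.cost_add_one_le hM (w := (Cmd.ite e c d).weight) (le_max_left _ _)
  have hc : T * (c.weight * (b + 1)) ≤ T * ((Cmd.ite e c d).weight * (b + 1)) := by
    gcongr
    exact (le_max_left _ _).trans (le_max_right _ _)
  have hd : T * (d.weight * (b + 1)) ≤ T * ((Cmd.ite e c d).weight * (b + 1)) := by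
    gcongr
    exact (le_max_right _ _).trans (le_max_right _ _)
  by_cases he : e.eval M = 0
  · obtain ⟨t, M', hexec, ht, hM', hQ⟩ := h₂ he hM
    exact ⟨_, M', .ite_false he hexec, by linarith, hM', hQ⟩
  · obtain ⟨t, M', hexec, ht, hM', hQ⟩ := h₁ he hM
    exact ⟨_, M', .ite_true he hexec, by linarith, hM', hQ⟩

theorem loop {Inv : ℕ → Mem → Prop} {G k : ℕ}
    (step : ∀ k M', Inv k M' → e.eval M' ≠ 0 → k < G ∧ Runs b c M' T (Inv (k + 1)))
    (hk : Inv k M) :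
    Runs b (.loop e c) M ((G - k) * (T + 1) + 1) (fun M' => ∃ l, Inv l M' ∧ e.eval M' = 0) := by
  generalize hm : G - k = m
  induction m generalizing k M with
  | zero =>
    intro hM
    have he : e.eval M = 0 := by
      by_contra he
      have hlt := (step k M hk he).1
      omega
    refine ⟨_, M, .loop_done he, ?_, hM, k, hk, he⟩
    linarith [e.cost_add_one_le hM (w := (Cmd.loop e c).weight) (le_max_left _ _)]
  | succ m ih =>
    intro hM
    have htest := e.cost_add_one_le hM (w := (Cmd.loop e c).weight) (le_max_left _ _)
    by_cases he : e.eval M = 0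
    · exact ⟨_, M, .loop_done he, htest.trans (Nat.le_mul_of_pos_left _ (by omega)), hM, k, hk, he⟩
    · obtain ⟨t₁, M', hexec₁, ht₁, hM', hInv⟩ := (step k M hk he).2 hM
      obtain ⟨t₂, M'', hexec₂, ht₂, hM'', hend⟩ := ih hInv (by omega) hM'
      refine ⟨_, M'', .loop_step he hexec₁ hexec₂, ?_, hM'', hend⟩
      have hbody : T * (c.weight * (b + 1)) ≤ T * ((Cmd.loop e c).weight * (b + 1)) := by
        gcongr
        exact le_max_right _ _
      linarith

theorem loop_framed {Inv : ℕ → Mem → Prop} {G k : ℕ}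
    (step : ∀ k M', AgreeOff c.writes M M' → Inv k M' → e.eval M' ≠ 0 →
      k < G ∧ Runs b c M' T (Inv (k + 1)))
    (hk : Inv k M) :
    Runs b (.loop e c) M ((G - k) * (T + 1) + 1)
      (fun M' => AgreeOff c.writes M M' ∧ ∃ l, Inv l M' ∧ e.eval M' = 0) := by
  refine (loop (Inv := fun k M' => AgreeOff c.writes M M' ∧ Inv k M') (G := G) (T := T) ?_
    ⟨.refl _ M, hk⟩).mono le_rfl ?_
  · rintro k M' ⟨hagree, hInv⟩ he
    obtain ⟨hlt, hrun⟩ := step k M' hagree hInv he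
    exact ⟨hlt, hrun.framed.mono le_rfl fun M'' h => ⟨hagree.trans h.1, h.2⟩⟩
  · rintro M' ⟨l, ⟨hagree, hInv⟩, he⟩
    exact ⟨hagree, l, hInv, he⟩

end Runs

instance : Add Expr := ⟨.bin .add⟩
instance : Sub Expr := ⟨.bin .sub⟩
instance : Mul Expr := ⟨.bin .mul⟩
instance : Div Expr := ⟨.bin .div⟩

section Eval

variable (M : Mem) (e f : Expr)

@[simp] theorem Expr.eval_lit (n : ℕ) : (Expr.lit n).eval M = n := rfl
@[simp] theorem Expr.eval_get (x : ℕ) : (Expr.get x e).eval M = M x (e.eval M) := rfl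
@[simp] theorem Expr.eval_add : (e + f).eval M = e.eval M + f.eval M := rfl
@[simp] theorem Expr.eval_sub : (e - f).eval M = e.eval M - f.eval M := rfl
@[simp] theorem Expr.eval_mul : (e * f).eval M = e.eval M * f.eval M := rfl
@[simp] theorem Expr.eval_div : (e / f).eval M = e.eval M / f.eval M := rfl

/-- Cell `0` of bank `x`, used as a scalar variable. -/
def var (x : ℕ) : Expr := .get x (.lit 0)

@[simp] theorem eval_var (x : ℕ) : (var x).eval M = M x 0 := rfl

end Eval

/-- Assignment to a scalar variable. -/
def assign (x : ℕ) (e : Expr) : Cmd := .set x (.lit 0) e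

/-- Run `c` for the values `e, e + 1, …, f - 1` of the variable `x`. Neither `x` nor the banks read
by `f` may be written by `c`. -/
def forLoop (x : ℕ) (e f : Expr) (c : Cmd) : Cmd :=
  .seq (assign x e) (.loop (f - var x) (.seq c (assign x (var x + .lit 1))))

namespace Runs

variable {b x T : ℕ} {c : Cmd} {e f : Expr} {M : Mem} {Q : Mem → Prop}

theorem assign (he : e.eval M < 2 ^ b) (h : Q (M.write x 0 (e.eval M))) :
    Runs b (RAM.assign x e) M 1 Q :=
  set he h

theorem assign_seq (he : e.eval M < 2 ^ b) (h : Runs b c (M.write x 0 (e.eval M)) T Q) :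
    Runs b (.seq (RAM.assign x e) c) M (1 + T) Q :=
  set_seq he h

theorem forLoop {Inv : ℕ → Mem → Prop} {n k₀ : ℕ} (hx : x ∉ c.writes) (he : e.eval M = k₀)
    (hk₀ : k₀ ≤ n) (hn : n < 2 ^ b)
    (hf : ∀ M', AgreeOff (x :: c.writes) M M' → f.eval M' = n)
    (hInv : ∀ k M' v, Inv k M' → Inv k (M'.write x 0 v)) (init : Inv k₀ M)
    (step : ∀ k M', AgreeOff (x :: c.writes) M M' → M' x 0 = k → k₀ ≤ k → k < n → Inv k M' →
      Runs b c M' T (Inv (k + 1))) :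
    Runs b (RAM.forLoop x e f c) M ((n - k₀) * (T + 2) + 2) (Inv n) := by
  have hsub : (Cmd.seq c (RAM.assign x (var x + .lit 1))).writes ⊆ x :: c.writes := by
    simp [Cmd.writes, RAM.assign]
  have hstart : AgreeOff (x :: c.writes) M (M.write x 0 (e.eval M)) :=
    (M.agreeOff_write x 0 _).mono (by simp)
  refine (assign_seq (by omega) ((loop_framed (G := n) (T := T + 1) (k := k₀)
    (Inv := fun k M' => M' x 0 = k ∧ k₀ ≤ k ∧ k ≤ n ∧ Inv k M') ?_ ?_).mono le_rfl ?_)).mono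
    (by rw [Nat.add_comm 1]) fun _ => id
  · rintro k M' hM' ⟨hcounter, hk₀, -, hk⟩ hguard
    have hagree := hstart.trans (hM'.mono hsub)
    have hlt : k < n := by
      simp only [Expr.eval_sub, eval_var, hf M' hagree, hcounter] at hguard
      omega
    refine ⟨hlt, (step k M' hagree hcounter hk₀ hlt hk).framed.seq fun M'' ⟨hoff, hk'⟩ => ?_⟩
    have hcounter' : M'' x 0 = k := by rw [hoff x hx, hcounter]
    exact assign (by simp; omega) ⟨by simp [hcounter'], by omega, hlt, hInv _ _ _ hk'⟩
  · exact ⟨by simp [he], le_rfl, hk₀, hInv _ _ _ init⟩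
  · rintro M' ⟨hM', k, ⟨hcounter, -, hk, hInvk⟩, hguard⟩
    simp only [Expr.eval_sub, eval_var, hf M' (hstart.trans (hM'.mono hsub)), hcounter] at hguard
    obtain rfl : k = n := by omega
    exact hInvk

end Runs

end RAM

/-! ## The auction algorithm for the assignment problem -/

/-- `o` assigns the persons `1, …, r` to the objects `0, …, r - 1`, bijectively. -/
def IsAssignment (r : ℕ) (o : ℕ → ℕ) : Prop := Set.BijOn o (Set.Iio r) (Set.Icc 1 r)

theorem isAssignment_of_injOn {r : ℕ} {o : ℕ → ℕ} (hmaps : Set.MapsTo o (Set.Iio r) (Set.Icc 1 r))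
    (hinj : Set.InjOn o (Set.Iio r)) : IsAssignment r o := by
  refine ⟨hmaps, hinj, ?_⟩
  have hsurj := Finset.surjOn_of_injOn_of_card_le (s := .range r) (t := .Icc 1 r) o
    (by simpa using hmaps) (by simpa using hinj) (by simp)
  simpa using hsurj

theorem sum_le_sum_add_card_nsmul_of_slackness {ι κ R : Type*} [AddCommMonoid R] [PartialOrder R]
    [IsOrderedCancelAddMonoid R] {s : Finset ι} {o σ : ι → κ} {w : κ → ι → R} {p : ι → R} {ε : R}
    (ho : Set.InjOn o s) (hσ : ∀ i ∈ s, ∃ i' ∈ s, σ i' = o i)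
    (hslack : ∀ i ∈ s, ∀ i' ∈ s, w (o i) i + p i ≤ w (o i) i' + p i' + ε) :
    ∑ i ∈ s, w (o i) i ≤ ∑ i ∈ s, w (σ i) i + s.card • ε := by
  choose! f hfs hf using hσ
  have hinj : Set.InjOn f s := fun i hi i' hi' h => ho hi hi' (by rw [← hf i hi, ← hf i' hi', h])
  have hsurj := Finset.surjOn_of_injOn_of_card_le f hfs hinj le_rfl
  refine le_of_add_le_add_right (a := ∑ i ∈ s, p i) ?_
  calc ∑ i ∈ s, w (o i) i + ∑ i ∈ s, p i
      ≤ ∑ i ∈ s, (w (σ (f i)) (f i) + p (f i) + ε) := by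
        rw [← Finset.sum_add_distrib]
        exact Finset.sum_le_sum fun i hi => by simpa only [hf i hi] using hslack i hi _ (hfs i hi)
    _ = ∑ i ∈ s, (w (σ i) i + p i + ε) :=
        Finset.sum_nbij f hfs hinj hsurj fun _ _ => rfl
    _ = ∑ i ∈ s, w (σ i) i + s.card • ε + ∑ i ∈ s, p i := by
        simp only [Finset.sum_add_distrib, Finset.sum_const]
        abel

/-- A state of the auction: `sold` objects have an owner, `bidder` makes the next bid, `owner i` is
the owner of the object `i`, with `0` for an object without owner, and `price i` is its price. The
persons enter in the order `1, 2, …`; a new one enters when nobody present is without an object. -/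
structure AuctionState where
  sold : ℕ
  bidder : ℕ
  owner : ℕ → ℕ
  price : ℕ → ℕ

namespace AuctionState

/-- The bidder takes the object `i`, whose price rises by one; the previous owner, or else the next
person, becomes the bidder. -/
def bid (S : AuctionState) (i : ℕ) : AuctionState where
  sold := if S.owner i = 0 then S.sold + 1 else S.sold
  bidder := if S.owner i = 0 then S.sold + 2 else S.owner i
  owner := Function.update S.owner i S.bidder
  price := Function.update S.price i (S.price i + 1)

/-- The objects among `0, …, r - 1` that have an owner. -/
def soldObjects (S : AuctionState) (r : ℕ) : Finset ℕ :=
  (Finset.range r).filter fun i => S.owner i ≠ 0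

/-- The invariant of the auction of `r` objects for the costs `w j i ≤ W` of giving the object `i`
to the person `j`. -/
structure Valid (r W : ℕ) (w : ℕ → ℕ → ℕ) (S : AuctionState) : Prop where
  one_le_bidder : 1 ≤ S.bidder
  bidder_le : S.bidder ≤ S.sold + 1
  bidder_of_sold_eq : S.sold = r → S.bidder = r + 1
  price_le : ∀ i < r, S.price i ≤ W + 1
  price_eq_zero : ∀ i < r, S.owner i = 0 → S.price i = 0
  owner_le : ∀ i < r, S.owner i ≤ S.sold + 1
  owner_ne : ∀ i < r, S.owner i ≠ S.bidder
  owner_inj : ∀ i < r, ∀ i' < r, S.owner i ≠ 0 → S.owner i = S.owner i' → i = i'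
  card_soldObjects : (S.soldObjects r).card = S.sold
  slack : ∀ i < r, S.owner i ≠ 0 → ∀ k < r,
    w (S.owner i) i + S.price i ≤ w (S.owner i) k + S.price k + 1

/-- The object `i` is cheapest, price included, for the bidder. -/
def IsBest (r : ℕ) (w : ℕ → ℕ → ℕ) (S : AuctionState) (i : ℕ) : Prop :=
  i < r ∧ ∀ i' < r, w S.bidder i + S.price i ≤ w S.bidder i' + S.price i'

variable {r W i : ℕ} {w : ℕ → ℕ → ℕ} {S : AuctionState}

theorem soldObjects_bid (hi : i < r) (hbidder : S.bidder ≠ 0) :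
    (S.bid i).soldObjects r = insert i (S.soldObjects r) := by
  ext i'
  simp only [soldObjects, bid, Function.update_apply, Finset.mem_filter, Finset.mem_range,
    Finset.mem_insert]
  split_ifs with h <;> simp [h, hi, hbidder]

theorem sum_price_bid (hi : i < r) :
    ∑ i' ∈ Finset.range r, (S.bid i).price i' = ∑ i' ∈ Finset.range r, S.price i' + 1 := by
  have hmem := Finset.mem_range.2 hi
  rw [bid, Finset.sum_update_of_mem hmem, Finset.sdiff_singleton_eq_erase,
    ← Finset.add_sum_erase _ S.price hmem, add_right_comm]

namespace Valid

theorem initial (hr : 0 < r) (hsold : S.sold = 0) (hbidder : S.bidder = 1)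
    (howner : ∀ i < r, S.owner i = 0) (hprice : ∀ i < r, S.price i = 0) : S.Valid r W w where
  one_le_bidder := hbidder.ge
  bidder_le := by omega
  bidder_of_sold_eq h := by omega
  price_le i hi := by simp [hprice i hi]
  price_eq_zero i hi _ := hprice i hi
  owner_le i hi := by simp [howner i hi]
  owner_ne i hi := by simp [howner i hi, hbidder]
  owner_inj i hi _ _ h := absurd (howner i hi) h
  card_soldObjects := by
    rw [hsold, Finset.card_eq_zero, soldObjects, Finset.filter_eq_empty_iff]
    simpa using howner
  slack i hi h := absurd (howner i hi) h

theorem sold_le (h : S.Valid r W w) : S.sold ≤ r := by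
  simpa [← h.card_soldObjects, soldObjects] using
    Finset.card_filter_le (Finset.range r) (fun i => S.owner i ≠ 0)

theorem owner_ne_zero_iff (h : S.Valid r W w) : (∀ i < r, S.owner i ≠ 0) ↔ S.sold = r := by
  simpa [← h.card_soldObjects, soldObjects] using
    (Finset.card_filter_eq_iff (s := Finset.range r) (p := fun i => S.owner i ≠ 0)).symm

theorem sum_price_le (h : S.Valid r W w) :
    ∑ i ∈ Finset.range r, S.price i ≤ r * (W + 1) := by
  simpa using Finset.sum_le_card_nsmul (Finset.range r) S.price (W + 1)
    fun i hi => h.price_le i (Finset.mem_range.1 hi)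

/-- An object without owner is still free of charge, so the bidder pays no more than `W` for the
cheapest one. -/
theorem price_le_of_isBest (h : S.Valid r W w) (hsold : S.sold < r) (hw : ∀ j i, w j i ≤ W)
    (hi : S.IsBest r w i) : S.price i ≤ W := by
  obtain ⟨i', hi', hfree⟩ : ∃ i' < r, S.owner i' = 0 := by
    by_contra! hne
    exact hsold.ne (h.owner_ne_zero_iff.1 hne)
  have hbest := hi.2 i' hi'
  have hzero := h.price_eq_zero i' hi' hfree
  have hle := hw S.bidder i'
  omega

theorem card_soldObjects_bid (h : S.Valid r W w) (hi : i < r) :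
    ((S.bid i).soldObjects r).card = (S.bid i).sold := by
  rw [soldObjects_bid hi (by have := h.one_le_bidder; omega)]
  by_cases hfree : S.owner i = 0
  · rw [Finset.card_insert_of_notMem (by simp [soldObjects, hfree]), h.card_soldObjects]
    simp [bid, hfree]
  · rw [Finset.insert_eq_of_mem (by simp [soldObjects, hfree, hi]), h.card_soldObjects]
    simp [bid, hfree]

theorem slack_bid (h : S.Valid r W w) (hi : S.IsBest r w i) (i₁ : ℕ) (hi₁ : i₁ < r)
    (howned : (S.bid i).owner i₁ ≠ 0) (i₂ : ℕ) (hi₂ : i₂ < r) :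
    w ((S.bid i).owner i₁) i₁ + (S.bid i).price i₁ ≤
      w ((S.bid i).owner i₁) i₂ + (S.bid i).price i₂ + 1 := by
  have hprice : S.price i₂ ≤ (S.bid i).price i₂ := by
    simp only [bid, Function.update_apply]
    split_ifs with heq
    · rw [heq]; omega
    · exact le_rfl
  by_cases heq : i₁ = i
  · have hbest := hi.2 i₂ hi₂
    simp only [heq, bid, Function.update_self] at hprice ⊢
    omega
  · simp only [bid, Function.update_of_ne heq] at howned hprice ⊢
    have hslack := h.slack i₁ hi₁ howned i₂ hi₂
    omega

theorem bid (h : S.Valid r W w) (hsold : S.sold < r) (hw : ∀ j i, w j i ≤ W)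
    (hi : S.IsBest r w i) : (S.bid i).Valid r W w := by
  have hpos := h.one_le_bidder
  have hbidder := h.bidder_le
  have hprice := h.price_le_of_isBest hsold hw hi
  have howner := h.owner_le i hi.1
  refine
    { one_le_bidder := ?_
      bidder_le := ?_
      bidder_of_sold_eq := ?_
      price_le := ?_
      price_eq_zero := ?_
      owner_le := ?_
      owner_ne := ?_
      owner_inj := ?_
      card_soldObjects := h.card_soldObjects_bid hi.1
      slack := h.slack_bid hi }
  all_goals simp only [AuctionState.bid, Function.update_apply]
  · split_ifs <;> omega
  · split_ifs <;> omega
  · split_ifs <;> omega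
  · intro i' hi'
    have hle := h.price_le i' hi'
    split_ifs <;> omega
  · intro i' hi'
    have hzero := h.price_eq_zero i' hi'
    split_ifs <;> omega
  · intro i' hi'
    have hle := h.owner_le i' hi'
    split_ifs <;> omega
  · intro i' hi'
    have hle := h.owner_le i' hi'
    have hne := h.owner_ne i hi.1
    have hinj := h.owner_inj i hi.1 i' hi'
    split_ifs <;> omega
  · intro i₁ hi₁ i₂ hi₂
    have hinj := h.owner_inj i₁ hi₁ i₂ hi₂
    have hne₁ := h.owner_ne i₁ hi₁
    have hne₂ := h.owner_ne i₂ hi₂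
    split_ifs <;> omega

theorem isAssignment (h : S.Valid r W w) (hsold : S.sold = r) : IsAssignment r S.owner := by
  have hne := h.owner_ne_zero_iff.2 hsold
  refine isAssignment_of_injOn (fun i hi => ⟨?_, ?_⟩) fun i hi i' hi' => h.owner_inj i hi i' hi'
    (hne i hi)
  · exact Nat.one_le_iff_ne_zero.2 (hne i hi)
  · have hle := h.owner_le i hi
    have hbidder := h.owner_ne i hi
    have hlast := h.bidder_of_sold_eq hsold
    omega

theorem sum_le (h : S.Valid r W w) (hsold : S.sold = r) {σ : ℕ → ℕ} (hσ : IsAssignment r σ) :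
    ∑ i ∈ Finset.range r, w (S.owner i) i ≤ ∑ i ∈ Finset.range r, w (σ i) i + r := by
  have ho := h.isAssignment hsold
  have hne := h.owner_ne_zero_iff.2 hsold
  have hle := sum_le_sum_add_card_nsmul_of_slackness (s := Finset.range r) (o := S.owner) (σ := σ)
    (w := w) (p := S.price) (ε := 1) (by simpa using ho.injOn) ?_ ?_
  · simpa using hle
  · intro i hi
    obtain ⟨i', hi', heq⟩ := hσ.surjOn (ho.mapsTo (Finset.mem_range.1 hi))
    exact ⟨i', Finset.mem_range.2 hi', heq⟩
  · intro i hi i' hi'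
    rw [Finset.mem_range] at hi hi'
    exact h.slack i hi (hne i hi) i' hi'

end Valid

end AuctionState

/-! ## Guesses for the two factors -/

/-- `α` is a guess for `A` from above with relative error at most `1 / N`, and is not larger than
`A` itself; for `A = 0` it is `1`. -/
structure IsGuess (N α A : ℕ) : Prop where
  pos : 0 < α
  mul_le : A * N ≤ α * (N + 1)
  le_max : α ≤ max A 1

/-- The geometric grid `1 = x₀ < x₁ < …` with ratio about `1 + 1 / N` from which the guesses are
taken. -/
def grid (N : ℕ) : ℕ → ℕ
  | 0 => 1
  | k + 1 => grid N k + grid N k / N + 1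

theorem grid_strictMono (N : ℕ) : StrictMono (grid N) :=
  strictMono_nat_of_lt_succ fun _ => Nat.lt_succ_of_le (Nat.le_add_right _ _)

theorem one_le_grid (N k : ℕ) : 1 ≤ grid N k := (grid_strictMono N).monotone k.zero_le

theorem grid_add_le {N : ℕ} (k l : ℕ) :
    grid N k + l * (grid N k / N + 1) ≤ grid N (k + l) := by
  induction l with
  | zero => simp
  | succ l ih =>
    have hmono : grid N k / N ≤ grid N (k + l) / N :=
      Nat.div_le_div_right ((grid_strictMono N).monotone (by omega))
    rw [← add_assoc, grid]
    nlinarith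

theorem two_pow_le_grid {N : ℕ} (hN : 0 < N) (l : ℕ) : 2 ^ l ≤ grid N (N * l) := by
  induction l with
  | zero => exact one_le_grid N _
  | succ l ih =>
    have hdouble := grid_add_le (N := N) (N * l) N
    have hdiv := Nat.lt_mul_div_succ (grid N (N * l)) hN
    rw [mul_add, mul_one, pow_succ]
    nlinarith

theorem exists_grid_le_lt_grid_succ (N : ℕ) {m : ℕ} (hm : 1 ≤ m) :
    ∃ k, grid N k ≤ m ∧ m < grid N (k + 1) := by
  induction m, hm using Nat.le_induction with
  | base => exact ⟨0, le_rfl, grid_strictMono N Nat.one_pos⟩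
  | succ m _ ih =>
    obtain ⟨k, hk, hlt⟩ := ih
    rcases Nat.lt_or_ge (m + 1) (grid N (k + 1)) with h | h
    · exact ⟨k, hk.trans m.le_succ, h⟩
    · exact ⟨k + 1, h, lt_of_le_of_lt hlt (grid_strictMono N (k + 1).lt_succ_self)⟩

theorem exists_isGuess_grid (N A : ℕ) : ∃ k, IsGuess N (grid N k) A := by
  obtain ⟨k, hk, hlt⟩ := exists_grid_le_lt_grid_succ N (le_max_right A 1)
  refine ⟨k, one_le_grid N k, ?_, hk⟩
  have hA : A ≤ grid N k + grid N k / N := (le_max_left A 1).trans (Nat.lt_succ_iff.1 hlt)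
  calc A * N ≤ (grid N k + grid N k / N) * N := Nat.mul_le_mul_right N hA
    _ = grid N k * N + grid N k / N * N := add_mul _ _ _
    _ ≤ grid N k * N + grid N k := by gcongr; exact Nat.div_mul_le_self _ _
    _ = grid N k * (N + 1) := by ring

theorem IsGuess.div_le {N α A : ℕ} (h : IsGuess N α A) (hN : 0 < N) :
    (A : ℚ) / α ≤ 1 + 1 / N := by
  have hα : (0 : ℚ) < α := Nat.cast_pos.2 h.pos
  have hNq : (0 : ℚ) < N := Nat.cast_pos.2 hN
  have hmul : (A : ℚ) * N ≤ α * (N + 1) := by exact_mod_cast h.mul_le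
  rw [div_le_iff₀ hα, ← mul_le_mul_iff_left₀ hNq]
  calc (A : ℚ) * N ≤ α * (N + 1) := hmul
    _ = (1 + 1 / N) * α * N := by field_simp

/-- The entry with costs `x` and `y` in the linear assignment problem for the guesses `α` and `β`:
`K (x / α + y / β)`, rounded, and capped at `4 K` (in terms of truncated subtraction, as the
program computes it). -/
def scaledWeight (K α β x y : ℕ) : ℕ := 4 * K - (4 * K - (K * x / α + K * y / β))

section ScaledWeight

variable {K α β x y : ℕ}

theorem scaledWeight_eq (K α β x y : ℕ) :
    scaledWeight K α β x y = min (4 * K) (K * x / α + K * y / β) := by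
  rw [scaledWeight]
  generalize K * x / α + K * y / β = z
  omega

theorem scaledWeight_comm (K α β x y : ℕ) :
    scaledWeight K α β x y = scaledWeight K β α y x := by
  rw [scaledWeight, scaledWeight, add_comm (K * x / α)]

theorem scaledWeight_le (K α β x y : ℕ) :
    (scaledWeight K α β x y : ℚ) ≤ K * (x / α + y / β) := by
  have hle : scaledWeight K α β x y ≤ K * x / α + K * y / β :=
    (scaledWeight_eq ..).trans_le (min_le_right _ _)
  calc (scaledWeight K α β x y : ℚ) ≤ (K * x / α : ℕ) + (K * y / β : ℕ) := by exact_mod_cast hle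
    _ ≤ (K * x : ℕ) / α + (K * y : ℕ) / β := add_le_add Nat.cast_div_le Nat.cast_div_le
    _ = K * (x / α + y / β) := by push_cast; ring

theorem le_scaledWeight_add_two (hα : 0 < α) (hβ : 0 < β) (hlt : scaledWeight K α β x y < 4 * K) :
    (K * (x / α + y / β) : ℚ) ≤ scaledWeight K α β x y + 2 := by
  have hdiv {m γ : ℕ} (hγ : 0 < γ) : (m : ℚ) / γ ≤ (m / γ : ℕ) + 1 := by
    rw [div_le_iff₀ (Nat.cast_pos.2 hγ), mul_comm]
    exact_mod_cast (Nat.lt_mul_div_succ m hγ).le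
  have heq : scaledWeight K α β x y = K * x / α + K * y / β := by
    rw [scaledWeight_eq] at hlt ⊢
    omega
  calc (K * (x / α + y / β) : ℚ) = (K * x : ℕ) / α + (K * y : ℕ) / β := by push_cast; ring
    _ ≤ ((K * x / α : ℕ) + 1) + ((K * y / β : ℕ) + 1) := add_le_add (hdiv hα) (hdiv hβ)
    _ = scaledWeight K α β x y + 2 := by rw [heq]; push_cast; ring

theorem eq_zero_of_scaledWeight_one_lt (hx : 4 ∣ x) (hlt : scaledWeight K 1 β x y < 4 * K) :
    x = 0 := by
  obtain ⟨q, rfl⟩ := hx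
  rw [scaledWeight_eq, Nat.div_one] at hlt
  rcases Nat.eq_zero_or_pos q with rfl | hq
  · rfl
  · have hcap : 4 * K ≤ K * (4 * q) + K * y / β := le_add_right (by nlinarith)
    exact absurd (min_eq_left hcap ▸ hlt) (lt_irrefl _)

end ScaledWeight

section ScaledWeightSum

variable {ι : Type*} {s : Finset ι} {K α β : ℕ} {x y : ι → ℕ}

theorem mul_sum_div_add_sum_div (s : Finset ι) (K α β : ℕ) (x y : ι → ℕ) :
    (∑ i ∈ s, K * (x i / α + y i / β) : ℚ) =
      K * ((∑ i ∈ s, x i : ℕ) / α + (∑ i ∈ s, y i : ℕ) / β) := by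
  push_cast
  rw [← Finset.mul_sum, Finset.sum_add_distrib, ← Finset.sum_div, ← Finset.sum_div]

theorem sum_scaledWeight_le (s : Finset ι) (K α β : ℕ) (x y : ι → ℕ) :
    ((∑ i ∈ s, scaledWeight K α β (x i) (y i) : ℕ) : ℚ) ≤
      K * ((∑ i ∈ s, x i : ℕ) / α + (∑ i ∈ s, y i : ℕ) / β) := by
  rw [← mul_sum_div_add_sum_div]
  push_cast
  exact Finset.sum_le_sum fun i _ => scaledWeight_le ..

theorem le_sum_scaledWeight_add (hα : 0 < α) (hβ : 0 < β)
    (hlt : ∀ i ∈ s, scaledWeight K α β (x i) (y i) < 4 * K) :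
    (K * ((∑ i ∈ s, x i : ℕ) / α + (∑ i ∈ s, y i : ℕ) / β) : ℚ) ≤
      (∑ i ∈ s, scaledWeight K α β (x i) (y i) : ℕ) + 2 * s.card := by
  rw [← mul_sum_div_add_sum_div]
  refine (Finset.sum_le_sum fun i hi => le_scaledWeight_add_two hα hβ (hlt i hi)).trans_eq ?_
  rw [Finset.sum_add_distrib]
  simp [mul_comm]

theorem sum_scaledWeight_le_of_isGuess {n : ℕ} (s : Finset ι) (hn : 0 < n)
    (hα : IsGuess (4 * n) α (∑ i ∈ s, x i)) (hβ : IsGuess (4 * n) β (∑ i ∈ s, y i)) :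
    ∑ i ∈ s, scaledWeight (12 * s.card * n) α β (x i) (y i) ≤
      2 * (12 * s.card * n) + 6 * s.card := by
  have : (0 : ℚ) < n := Nat.cast_pos.2 hn
  have hx := hα.div_le (by omega)
  have hy := hβ.div_le (by omega)
  have hle : ((∑ i ∈ s, scaledWeight (12 * s.card * n) α β (x i) (y i) : ℕ) : ℚ) ≤
      (2 * (12 * s.card * n) + 6 * s.card : ℕ) :=
    calc _ ≤ ((12 * s.card * n : ℕ) : ℚ) * ((∑ i ∈ s, x i : ℕ) / α + (∑ i ∈ s, y i : ℕ) / β) :=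
          sum_scaledWeight_le ..
      _ ≤ ((12 * s.card * n : ℕ) : ℚ) *
          (1 + 1 / (4 * n : ℕ) + (1 + 1 / (4 * n : ℕ))) := by gcongr
      _ = (2 * (12 * s.card * n) + 6 * s.card : ℕ) := by push_cast; field_simp; ring
  exact_mod_cast hle

end ScaledWeightSum

/-- By the inequality of the arithmetic and geometric means, a sum close to `2` forces a product
close to `1`. -/
theorem mul_mul_le_add_one_of_add_le {F : Type*} [Field F] [LinearOrder F] [IsStrictOrderedRing F]
    {n X Y : F} (hn : 1 ≤ n) (hX : 0 ≤ X) (hY : 0 ≤ Y) (h : 4 * n * (X + Y) ≤ 8 * n + 3) :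
    n * (X * Y) ≤ n + 1 := by
  have hamgm : 4 * (X * Y) ≤ (X + Y) ^ 2 := by nlinarith [sq_nonneg (X - Y)]
  have hsq : (4 * n * (X + Y)) ^ 2 ≤ (8 * n + 3) ^ 2 := by gcongr
  have hscaled : 64 * n * (n * (X * Y)) ≤ 64 * n * (n + 1) :=
    calc 64 * n * (n * (X * Y)) = 16 * n ^ 2 * (4 * (X * Y)) := by ring
      _ ≤ 16 * n ^ 2 * (X + Y) ^ 2 := by gcongr
      _ = (4 * n * (X + Y)) ^ 2 := by ring
      _ ≤ (8 * n + 3) ^ 2 := hsq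
      _ ≤ 64 * n * (n + 1) := by nlinarith
  exact le_of_mul_le_mul_left hscaled (by positivity)

section NearOptimal

variable {ι : Type*} {s : Finset ι} {n α β : ℕ} {x y : ι → ℕ}

theorem scaledWeight_lt_cap (hn : 0 < n)
    (hle : ∑ i ∈ s, scaledWeight (12 * s.card * n) α β (x i) (y i) ≤
      2 * (12 * s.card * n) + 7 * s.card) (i : ι) (hi : i ∈ s) :
    scaledWeight (12 * s.card * n) α β (x i) (y i) < 4 * (12 * s.card * n) := by
  have hsingle := Finset.single_le_sum
    (f := fun i => scaledWeight (12 * s.card * n) α β (x i) (y i)) (fun _ _ => Nat.zero_le _) hi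
  have hcard := Finset.card_pos.2 ⟨i, hi⟩
  nlinarith [Nat.mul_le_mul_left s.card hn]

theorem mul_mul_sum_le_of_sum_scaledWeight_le (hs : s.Nonempty) (hn : 0 < n)
    (hα : 0 < α) (hβ : 0 < β)
    (hle : ∑ i ∈ s, scaledWeight (12 * s.card * n) α β (x i) (y i) ≤
      2 * (12 * s.card * n) + 7 * s.card) :
    n * ((∑ i ∈ s, x i) * ∑ i ∈ s, y i) ≤ (n + 1) * (α * β) := by
  have : (0 : ℚ) < α := Nat.cast_pos.2 hα
  have : (0 : ℚ) < β := Nat.cast_pos.2 hβ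
  have : (0 : ℚ) < s.card := Nat.cast_pos.2 hs.card_pos
  set X : ℚ := (∑ i ∈ s, x i : ℕ) / α with hX
  set Y : ℚ := (∑ i ∈ s, y i : ℕ) / β with hY
  have hsum : 4 * n * (X + Y) ≤ (8 * n + 3 : ℚ) := by
    have hlow : ((12 * s.card * n : ℕ) : ℚ) * (X + Y) ≤
        (2 * (12 * s.card * n) + 7 * s.card : ℕ) + 2 * s.card :=
      (le_sum_scaledWeight_add hα hβ (scaledWeight_lt_cap hn hle)).trans
        (by gcongr)
    push_cast at hlow
    refine le_of_mul_le_mul_left (a := (3 * s.card : ℚ)) ?_ (by positivity)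
    linarith
  have hprod : n * (X * Y) ≤ (n + 1 : ℚ) :=
    mul_mul_le_add_one_of_add_le (by exact_mod_cast hn) (by positivity) (by positivity) hsum
  have hcast : (n : ℚ) * ((∑ i ∈ s, x i : ℕ) * (∑ i ∈ s, y i : ℕ)) ≤ (n + 1) * (α * β) :=
    calc _ = n * (X * Y) * (α * β) := by rw [hX, hY]; field_simp
      _ ≤ (n + 1) * (α * β) := by gcongr
  exact_mod_cast hcast

theorem sum_eq_zero_of_sum_scaledWeight_le (hn : 0 < n) (hx : ∀ i ∈ s, 4 ∣ x i)
    (hle : ∑ i ∈ s, scaledWeight (12 * s.card * n) 1 β (x i) (y i) ≤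
      2 * (12 * s.card * n) + 7 * s.card) :
    ∑ i ∈ s, x i = 0 :=
  Finset.sum_eq_zero fun i hi =>
    eq_zero_of_scaledWeight_one_lt (hx i hi) (scaledWeight_lt_cap hn hle i hi)

/-- For good guesses of the factors of the product `(∑ x') (∑ y')`, near optimality for the scaled
weights implies near optimality for the product. Costs divisible by `4` allow one to recognize a
factor that vanishes. -/
theorem mul_mul_sum_le_of_isGuess {x' y' : ι → ℕ} (hn : 0 < n)
    (hx : ∀ i ∈ s, 4 ∣ x i) (hy : ∀ i ∈ s, 4 ∣ y i)
    (hα : IsGuess (4 * n) α (∑ i ∈ s, x' i)) (hβ : IsGuess (4 * n) β (∑ i ∈ s, y' i))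
    (hle : ∑ i ∈ s, scaledWeight (12 * s.card * n) α β (x i) (y i) ≤
      ∑ i ∈ s, scaledWeight (12 * s.card * n) α β (x' i) (y' i) + s.card) :
    n * ((∑ i ∈ s, x i) * ∑ i ∈ s, y i) ≤ (n + 1) * ((∑ i ∈ s, x' i) * ∑ i ∈ s, y' i) := by
  rcases s.eq_empty_or_nonempty with rfl | hs
  · simp
  have hsmall : ∑ i ∈ s, scaledWeight (12 * s.card * n) α β (x i) (y i) ≤
      2 * (12 * s.card * n) + 7 * s.card := by
    linarith [sum_scaledWeight_le_of_isGuess s hn hα hβ]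
  rcases le_max_iff.1 hα.le_max with hαA | hα_one
  · rcases le_max_iff.1 hβ.le_max with hβB | hβ_one
    · exact (mul_mul_sum_le_of_sum_scaledWeight_le hs hn hα.pos hβ.pos hsmall).trans (by gcongr)
    · obtain rfl : β = 1 := le_antisymm hβ_one hβ.pos
      simp only [scaledWeight_comm _ α] at hsmall
      simp [sum_eq_zero_of_sum_scaledWeight_le hn hy hsmall]
  · obtain rfl : α = 1 := le_antisymm hα_one hα.pos
    simp [sum_eq_zero_of_sum_scaledWeight_le hn hx hsmall]

end NearOptimal

/-! ## The search over the guesses -/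

namespace RAM

open Finset (range)

/-! The banks used by the programs below; a bank named after a number holds it in its cell `0`. -/

namespace Bank

/-- The accuracy, followed by the encoding of the instance. -/
abbrev input : ℕ := 0

/-- The number of words written, followed by these words. -/
abbrev tour : ℕ := 1

/-- The first cost matrix; with `r` columns, the entry `(j, i)` is in cell `j * r + i`. -/
abbrev costA : ℕ := 2

/-- The second cost matrix, stored like the first. -/
abbrev costB : ℕ := 3

abbrev price : ℕ := 4
abbrev owner : ℕ := 5
abbrev multiple : ℕ := 6
abbrev bound : ℕ := 7
abbrev guessA : ℕ := 8
abbrev guessB : ℕ := 9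
abbrev best : ℕ := 10
abbrev sold : ℕ := 11
abbrev bidder : ℕ := 12
abbrev counter : ℕ := 13
abbrev object : ℕ := 14
abbrev totalA : ℕ := 15
abbrev totalB : ℕ := 16
abbrev previousOwner : ℕ := 17

end Bank

open Bank

/-- The accuracy. -/
abbrev nE : Expr := .get input (.lit 0)

/-- The number of objects. -/
abbrev rE : Expr := .get input (.lit 1)

/-- The number of vertices to insert. -/
abbrev sE : Expr := .get input (.lit 2)

/-- An assignment problem with two costs `A j i`, `B j i` of giving the object `i` to the person
`j`, to be solved with accuracy `1 / n`. There are `r` objects; the persons `1, …, s` stand for the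
vertices to be inserted, the persons `s + 1, …, r` for keeping an edge. -/
structure AssignmentData where
  n : ℕ
  r : ℕ
  s : ℕ
  A : ℕ → ℕ → ℕ
  B : ℕ → ℕ → ℕ

/-- The assignment problem stored in a memory. -/
def Mem.data (M : Mem) : AssignmentData where
  n := M input 0
  r := M input 1
  s := M input 2
  A j i := M costA (j * M input 1 + i)
  B j i := M costB (j * M input 1 + i)

/-- The state of the auction stored in a memory. -/
def Mem.auction (M : Mem) : AuctionState := ⟨M sold 0, M bidder 0, M owner, M price⟩

/-- The costs on which the auction is run for the guesses `α` and `β` of the two total costs. -/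
def AssignmentData.weight (D : AssignmentData) (α β j i : ℕ) : ℕ :=
  scaledWeight (12 * D.r * D.n) α β (D.A j i) (D.B j i)

/-- The weights belonging to the guesses stored in a memory. -/
def Mem.weight (M : Mem) : ℕ → ℕ → ℕ := M.data.weight (M guessA 0) (M guessB 0)

section Congruence

variable {xs : List ℕ} {M M' : Mem}

theorem AgreeOff.data_eq (h : AgreeOff xs M M') (hxs : ∀ x ∈ [input, costA, costB], x ∉ xs) :
    M'.data = M.data := by
  simp only [List.forall_mem_cons] at hxs
  simp only [Mem.data, h _ hxs.1, h _ hxs.2.1, h _ hxs.2.2.1]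

theorem AgreeOff.weight_eq (h : AgreeOff xs M M')
    (hxs : ∀ x ∈ [input, costA, costB, guessA, guessB], x ∉ xs) : M'.weight = M.weight := by
  simp only [List.forall_mem_cons] at hxs
  simp only [Mem.weight, Mem.data, h _ hxs.1, h _ hxs.2.1, h _ hxs.2.2.1, h _ hxs.2.2.2.1,
    h _ hxs.2.2.2.2.1]

theorem AgreeOff.auction_eq (h : AgreeOff xs M M')
    (hxs : ∀ x ∈ [sold, bidder, owner, price], x ∉ xs) : M'.auction = M.auction := by
  simp only [List.forall_mem_cons] at hxs
  simp only [Mem.auction, h _ hxs.1, h _ hxs.2.1, h _ hxs.2.2.1, h _ hxs.2.2.2.1]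

end Congruence

/-- Weight plus price of object `i` for the bidder. -/
def bidE (i : Expr) : Expr :=
  (.lit 4 * (.lit 12 * rE * nE) - (.lit 4 * (.lit 12 * rE * nE) -
    (.lit 12 * rE * nE * .get costA (var bidder * rE + i) / var guessA +
      .lit 12 * rE * nE * .get costB (var bidder * rE + i) / var guessB))) + .get price i

theorem eval_bidE (M : Mem) (i : Expr) : (bidE i).eval M =
    M.weight M.auction.bidder (i.eval M) + M.auction.price (i.eval M) := rfl

/-- Finds an object that is cheapest, price included, for the bidder. -/
def findBest : Cmd :=
  .seq (assign object (.lit 0)) <|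
    forLoop counter (.lit 1) rE <|
      .ite (bidE (var object) - bidE (var counter)) (assign object (var counter)) .skip

theorem findBest_runs {b r : ℕ} {M : Mem} (hr : M input 1 = r) (hr₀ : 0 < r) (hb : r < 2 ^ b) :
    Runs b findBest M (4 * r + 3) fun M' => M.auction.IsBest r M.weight (M' object 0) := by
  refine (Runs.assign_seq (by simp) <| Runs.forLoop (T := 2) (n := r) (k₀ := 1)
    (Inv := fun k M' => M.auction.IsBest k M.weight (M' object 0))
    (by decide) rfl hr₀ hb (fun M' hM' => by simp [hM' input (by decide), Mem.write_of_ne, hr])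
    ?_ ?_ ?_).mono (by omega) fun _ => id
  · exact fun k M' v hk => by simpa [Mem.write_of_ne] using hk
  · simp [AuctionState.IsBest]
  · intro k M' hagree hcounter _ hk ⟨hobject, hmin⟩
    replace hagree := hagree.of_write
    have heval (x : ℕ) : (bidE (var x)).eval M' =
        M.weight M.auction.bidder (M' x 0) + M.auction.price (M' x 0) := by
      rw [eval_bidE, hagree.weight_eq (by decide), hagree.auction_eq (by decide), eval_var]
    refine Runs.ite (fun hguard => ?_) fun hguard => Runs.skip ⟨by omega, fun i hi => ?_⟩ <;>
      rw [Expr.eval_sub, heval, heval, hcounter] at hguard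
    · refine Runs.assign (by simp; omega) ?_
      rw [Mem.write_self, eval_var, hcounter]
      refine ⟨by omega, fun i hi => ?_⟩
      obtain hi | rfl := Nat.lt_succ_iff_lt_or_eq.1 hi
      · linarith [hmin i hi, Nat.sub_ne_zero_iff_lt.1 hguard]
      · exact le_rfl
    · obtain hi | rfl := Nat.lt_succ_iff_lt_or_eq.1 hi
      · exact hmin i hi
      · omega

/-- The bidder takes the object found. -/
def takeObject : Cmd :=
  .seq (assign previousOwner (.get owner (var object))) <|
  .seq (.set owner (var object) (var bidder)) <|
  .seq (.set price (var object) (.get price (var object) + .lit 1)) <|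
  .ite (var previousOwner) (assign bidder (var previousOwner)) <|
  .seq (assign sold (var sold + .lit 1)) (assign bidder (var sold + .lit 1))

theorem takeObject_runs {b i : ℕ} {M : Mem} (hi : M object 0 = i) (hsold : M sold 0 + 2 < 2 ^ b)
    (hprice : M price i + 1 < 2 ^ b) :
    Runs b takeObject M 6 fun M' => M'.auction = M.auction.bid i := by
  intro hM
  refine (Runs.assign_seq (T := 5) (hM _ _) <| Runs.set_seq (T := 4) (hM _ _) <|
    Runs.set_seq (T := 3) ?_ <| Runs.ite (T := 2) (fun hold => ?_) fun hold => ?_) hM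
  · simpa [Mem.write_of_ne, hi] using hprice
  · replace hold : M owner i ≠ 0 := by simpa [Mem.write_of_ne, hi] using hold
    refine (Runs.assign ?_ ?_).mono one_le_two fun _ => id
    · simpa [Mem.write_of_ne] using hM _ _
    · simp [Mem.auction, AuctionState.bid, Mem.write_of_ne, Mem.write_bank, hi, hold]
  · replace hold : M owner i = 0 := by simpa [Mem.write_of_ne, hi] using hold
    refine Runs.assign_seq (T := 1) ?_ <| Runs.assign ?_ ?_
    · simpa [Mem.write_of_ne] using (show M sold 0 + 1 < 2 ^ b by omega)
    · simpa [Mem.write_of_ne] using hsold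
    · simp [Mem.auction, AuctionState.bid, Mem.write_of_ne, Mem.write_bank, hi, hold]

/-- One bid. -/
def bidStep : Cmd := .seq findBest takeObject

theorem bidStep_runs {b r : ℕ} {M : Mem} (hr : M input 1 = r) (hr₀ : 0 < r) (hb : r < 2 ^ b)
    (hsold : M sold 0 + 2 < 2 ^ b) (hprice : ∀ i < r, M price i + 1 < 2 ^ b) :
    Runs b bidStep M (4 * r + 9) fun M' =>
      ∃ i, M.auction.IsBest r M.weight i ∧ M'.auction = M.auction.bid i := by
  refine (findBest_runs hr hr₀ hb).framed.seq (T₂ := 6) fun M' ⟨hagree, hbest⟩ => ?_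
  refine (takeObject_runs rfl ?_ ?_).mono le_rfl fun M'' hM'' => ⟨_, hbest, ?_⟩
  · rwa [hagree sold (by decide)]
  · rw [hagree price (by decide)]
    exact hprice _ hbest.1
  · rw [hM'', hagree.auction_eq (by decide)]

/-- Brings the auction into its initial state. -/
def resetAuction : Cmd :=
  .seq (forLoop counter (.lit 0) rE <|
    .seq (.set price (var counter) (.lit 0)) (.set owner (var counter) (.lit 0))) <|
  .seq (assign sold (.lit 0)) (assign bidder (.lit 1))

theorem resetAuction_runs {b r : ℕ} {M : Mem} (hr : M input 1 = r) (hb : r + 1 < 2 ^ b) :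
    Runs b resetAuction M (4 * r + 4) fun M' => M'.auction.sold = 0 ∧ M'.auction.bidder = 1 ∧
      (∀ i < r, M'.auction.owner i = 0) ∧ ∀ i < r, M'.auction.price i = 0 := by
  refine ((Runs.forLoop (T := 2) (k₀ := 0) (n := r)
    (Inv := fun k M' => ∀ i < k, M' owner i = 0 ∧ M' price i = 0) (by decide) rfl r.zero_le
    (by omega) (fun M' hM' => by simp [hM' input (by decide), hr]) ?_ (by simp) ?_).seq
    fun M' hM' => Runs.assign_seq (T := 1) (by simp) <| Runs.assign ?_ ?_).mono (by omega)
    fun _ => id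
  · exact fun k M' v hk => by simpa [Mem.write_of_ne] using hk
  · intro k M' _ hcounter _ _ hzero
    refine Runs.set_seq (T := 1) (by simp) <| Runs.set (by simp) fun i hi => ?_
    have := hzero i
    simp only [Mem.write_apply, eval_var, Expr.eval_lit, hcounter, OfNat.ofNat_eq_ofNat,
      Nat.reduceEqDiff, Nat.succ_ne_self, false_and, true_and, ↓reduceIte, ite_eq_left_iff]
    omega
  · simp only [Expr.eval_lit]
    omega
  · simpa [Mem.auction, Mem.write_of_ne, imp_and, forall_and] using hM'

/-- The auction. -/
def auction : Cmd := .seq resetAuction (.loop (rE - var sold) bidStep)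

/-- A bound for the number of steps of an auction of `r` objects with weights at most `W`. -/
def auctionSteps (r W : ℕ) : ℕ := 4 * r + 4 + ((r * (W + 1) + 1) * (4 * r + 10) + 1)

theorem auction_runs {b r W : ℕ} {M : Mem} (hr : M input 1 = r) (hr₀ : 0 < r)
    (hW : ∀ j i, M.weight j i ≤ W) (hb : r + 1 < 2 ^ b) (hWb : W + 2 < 2 ^ b) :
    Runs b auction M (auctionSteps r W) fun M' => IsAssignment r (M' owner) ∧
      ∀ σ, IsAssignment r σ →
        ∑ i ∈ range r, M.weight (M' owner i) i ≤ ∑ i ∈ range r, M.weight (σ i) i + r := by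
  refine (resetAuction_runs hr hb).framed.seq
    fun M₁ ⟨hagree₁, hsold, hbidder, howner, hprice⟩ => ?_
  refine (Runs.loop_framed (k := 0) (G := r * (W + 1) + 1) (T := 4 * r + 9)
    (Inv := fun k M' => M'.auction.Valid r W M.weight ∧ ∑ i ∈ range r, M'.auction.price i = k)
    ?_ ?_).mono le_rfl ?_
  · rintro k M₂ hagree₂ ⟨hvalid, hsum⟩ hguard
    have hagree : AgreeOff (resetAuction.writes ++ bidStep.writes) M M₂ :=
      (hagree₁.mono (List.subset_append_left _ _)).trans
        (hagree₂.mono (List.subset_append_right _ _))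
    have hr₂ : M₂ input 1 = r := by rw [hagree input (by decide), hr]
    have hlt : M₂ sold 0 < r := by simpa [hr₂] using Nat.sub_ne_zero_iff_lt.1 hguard
    refine ⟨Nat.lt_succ_of_le (hsum ▸ hvalid.sum_price_le), ?_⟩
    refine (bidStep_runs hr₂ hr₀ (by omega) (by omega)
      fun i hi => (Nat.succ_le_succ (hvalid.price_le i hi)).trans_lt hWb).mono le_rfl ?_
    rintro M₃ ⟨i, hbest, hbid⟩
    rw [hagree.weight_eq (by decide)] at hbest
    rw [hbid]
    exact ⟨hvalid.bid hlt hW hbest, by rw [AuctionState.sum_price_bid hbest.1, hsum]⟩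
  · exact ⟨.initial hr₀ hsold hbidder howner hprice,
      Finset.sum_eq_zero fun i hi => hprice i (Finset.mem_range.1 hi)⟩
  · rintro M₂ ⟨hagree₂, k, ⟨hvalid, -⟩, hguard⟩
    have hr₂ : M₂ input 1 = r := by
      rw [hagree₂ input (by decide), hagree₁ input (by decide), hr]
    have hsold : M₂ sold 0 = r :=
      le_antisymm hvalid.sold_le (by simpa [hr₂] using Nat.sub_eq_zero_iff_le.1 hguard)
    exact ⟨hvalid.isAssignment hsold, fun σ hσ => hvalid.sum_le hsold hσ⟩

/-- The total cost of the assignment `o` of `r` objects for the costs `C`. -/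
def assignCost (C : ℕ → ℕ → ℕ) (r : ℕ) (o : ℕ → ℕ) : ℕ := ∑ i ∈ range r, C (o i) i

/-- Computes the two costs of the assignment. -/
def evaluate : Cmd :=
  .seq (assign totalA (.lit 0)) <| .seq (assign totalB (.lit 0)) <|
    forLoop counter (.lit 0) rE <|
      .seq (assign totalA (var totalA + .get costA (.get owner (var counter) * rE + var counter)))
        (assign totalB (var totalB + .get costB (.get owner (var counter) * rE + var counter)))

theorem evaluate_runs {b : ℕ} {D : AssignmentData} {M : Mem} (hD : M.data = D) (hb : D.r < 2 ^ b)
    (hA : assignCost D.A D.r (M owner) < 2 ^ b) (hB : assignCost D.B D.r (M owner) < 2 ^ b) :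
    Runs b evaluate M (4 * D.r + 4) fun M' => M' totalA 0 = assignCost D.A D.r (M owner) ∧
      M' totalB 0 = assignCost D.B D.r (M owner) := by
  have hle (C : ℕ → ℕ → ℕ) {k : ℕ} (hk : k < D.r) :
      assignCost C k (M owner) + C (M owner k) k ≤ assignCost C D.r (M owner) := by
    rw [assignCost, ← Finset.sum_range_succ]
    exact Finset.sum_le_sum_of_subset (Finset.range_subset_range.2 hk)
  have hr : M input 1 = D.r := congrArg AssignmentData.r hD
  refine (Runs.assign_seq (by simp) <| Runs.assign_seq (by simp) <| Runs.forLoop (T := 2)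
    (k₀ := 0) (n := D.r) (Inv := fun k M' => M' totalA 0 = assignCost D.A k (M owner) ∧
      M' totalB 0 = assignCost D.B k (M owner)) (by decide) rfl (Nat.zero_le _) hb
    (fun M' hM' => by simp [hM' input (by decide), Mem.write_of_ne, hr]) ?_
    (by simp [assignCost, Mem.write_of_ne]) ?_).mono (by omega) fun _ => id
  · exact fun k M' v hk => by simpa [Mem.write_of_ne] using hk
  · intro k M' hagree hcounter _ hk ⟨hA', hB'⟩
    replace hagree := hagree.of_write.of_write
    have hD' : M'.data = D := by rw [hagree.data_eq (by decide), hD]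
    have howner : M' owner = M owner := hagree owner (by decide)
    have hcellA : M' costA (M owner k * M' input 1 + k) = D.A (M owner k) k :=
      congrFun₂ (congrArg AssignmentData.A hD') _ _
    have hcellB : M' costB (M owner k * M' input 1 + k) = D.B (M owner k) k :=
      congrFun₂ (congrArg AssignmentData.B hD') _ _
    refine Runs.assign_seq (T := 1) ?_ <| Runs.assign ?_ ⟨?_, ?_⟩
    · simpa [hcounter, howner, hcellA, hA'] using (hle D.A hk).trans_lt hA
    · simpa [Mem.write_of_ne, hcounter, howner, hcellB, hB'] using (hle D.B hk).trans_lt hB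
    · simp [Mem.write_of_ne, hcounter, howner, hcellA, hA', assignCost, Finset.sum_range_succ]
    · simp [Mem.write_of_ne, hcounter, howner, hcellB, hB', assignCost, Finset.sum_range_succ]

/-- The part of the tour after the vertex `u_i`: first `v_j`, if there is such a vertex, and then
the next vertex of the cycle. Vertices are given by their numbers. -/
def tourStep (r s j i : ℕ) : List ℕ := (if j ≤ s then [r + j - 1] else []) ++ [(i + 1) % r]

/-- The first vertices of the tour that inserts `v_{o i}` into the `i`-th edge if `o i ≤ s`. -/
def tourList (r s : ℕ) (o : ℕ → ℕ) (k : ℕ) : List ℕ :=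
  (List.range k).flatMap fun i => tourStep r s (o i) i

theorem tourList_succ (r s : ℕ) (o : ℕ → ℕ) (k : ℕ) :
    tourList r s o (k + 1) = tourList r s o k ++ tourStep r s (o k) k := by
  simp [tourList, List.range_succ]

theorem length_tourStep_le (r s j i : ℕ) : (tourStep r s j i).length ≤ 2 := by
  unfold tourStep
  split_ifs <;> simp

theorem length_tourList_le (r s : ℕ) (o : ℕ → ℕ) (k : ℕ) : (tourList r s o k).length ≤ 2 * k := by
  simpa [tourList, mul_comm] using
    List.sum_le_card_nsmul ((List.range k).map fun i => (tourStep r s (o i) i).length) 2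
      (by simpa using fun i _ => length_tourStep_le r s (o i) i)

/-- The remainder of `e` modulo `f`. -/
def modE (e f : Expr) : Expr := e - f * (e / f)

@[simp] theorem eval_modE (M : Mem) (e f : Expr) : (modE e f).eval M = e.eval M % f.eval M :=
  Nat.mod_eq_sub_mul_div.symm

theorem length_output (M : Mem) : (output M).length = M tour 0 := by simp [output]

theorem output_congr {M M' : Mem} (h : M' tour = M tour) : output M' = output M := by
  rw [output, output, h]

/-- Appends a word to the output. -/
def push (e : Expr) : Cmd :=
  .seq (.set tour (var tour + .lit 1) e) (assign tour (var tour + .lit 1))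

theorem push_runs {b : ℕ} {M : Mem} {e : Expr} (he : e.eval M < 2 ^ b)
    (hb : (output M).length + 1 < 2 ^ b) :
    Runs b (push e) M 2 fun M' => output M' = output M ++ [e.eval M] := by
  rw [length_output] at hb
  refine Runs.set_seq (T := 1) he <| Runs.assign (by simpa [Mem.write_apply] using hb) ?_
  simp [output, Mem.write_apply, List.range_succ]
  omega

/-- Appends the part of the tour after the current vertex to the output. -/
def writeStep : Cmd :=
  .seq (.ite (sE + .lit 1 - .get owner (var counter))
      (push (rE + .get owner (var counter) - .lit 1)) .skip)
    (push (modE (var counter + .lit 1) rE))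

theorem writeStep_runs {b r s i j : ℕ} {M : Mem} (hr : M input 1 = r) (hs : M input 2 = s)
    (hi : M counter 0 = i) (hj : M owner i = j) (hir : i + 1 < 2 ^ b) (hjr : r + j < 2 ^ b)
    (hlen : (output M).length + 2 < 2 ^ b) :
    Runs b writeStep M 5 fun M' => output M' = output M ++ tourStep r s j i := by
  refine (Runs.ite (T := 2) (Q := fun M' => AgreeOff [tour] M M' ∧
    output M' = output M ++ if j ≤ s then [r + j - 1] else []) (fun hguard => ?_)
    fun hguard => ?_).seq (T₂ := 2) fun M' ⟨hagree, hout⟩ => ?_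
  · replace hguard : j ≤ s := by
      simp only [Expr.eval_sub, Expr.eval_add, Expr.eval_get, Expr.eval_lit, eval_var, hs, hi,
        hj] at hguard
      omega
    refine (push_runs ?_ (by omega)).framed.mono le_rfl fun M' ⟨hagree, hout⟩ =>
      ⟨hagree.mono (by decide), by simpa [hr, hi, hj, hguard] using hout⟩
    simp only [Expr.eval_sub, Expr.eval_add, Expr.eval_get, Expr.eval_lit, eval_var, hr, hi, hj]
    omega
  · replace hguard : ¬ j ≤ s := by
      simp only [Expr.eval_sub, Expr.eval_add, Expr.eval_get, Expr.eval_lit, eval_var, hs, hi,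
        hj] at hguard
      omega
    exact (Runs.skip ⟨.refl _ M, by simp [hguard]⟩).mono one_le_two fun _ => id
  · have hmod : (modE (var counter + .lit 1) rE).eval M' = (i + 1) % r := by
      simp [hagree counter (by decide), hagree input (by decide), hi, hr]
    refine (push_runs ?_ ?_).mono le_rfl fun M'' hout' => ?_
    · exact hmod ▸ (Nat.mod_le _ _).trans_lt hir
    · rw [hout, List.length_append]
      split_ifs <;> simp <;> omega
    · rw [hout', hmod, hout, List.append_assoc, tourStep]

/-- Writes the tour that belongs to the assignment to the output. -/
def writeTour : Cmd :=
  .seq (assign tour (.lit 0)) <| forLoop counter (.lit 0) rE writeStep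

theorem writeTour_runs {b r s : ℕ} {M : Mem} (hr : M input 1 = r) (hs : M input 2 = s)
    (ho : ∀ i < r, M owner i ≤ r) (hb : 2 * r + 2 < 2 ^ b) :
    Runs b writeTour M (7 * r + 3) fun M' => output M' = tourList r s (M owner) r := by
  refine (Runs.assign_seq (by simp) <| Runs.forLoop (T := 5) (k₀ := 0) (n := r)
    (Inv := fun k M' => output M' = tourList r s (M owner) k) (by decide) rfl r.zero_le (by omega)
    (fun M' hM' => by simp [hM' input (by decide), Mem.write_of_ne, hr]) ?_
    (by simp [output, tourList]) ?_).mono (by omega) fun _ => id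
  · exact fun k M' v hk => (output_congr (Mem.write_of_ne _ _ _ (by decide))).trans hk
  · intro k M' hagree hcounter _ hk hout
    replace hagree := hagree.of_write
    have := ho k hk
    refine (writeStep_runs (r := r) (s := s) ?_ ?_ hcounter (congrFun (hagree owner (by decide)) k)
      (by omega) (by omega) ?_).mono le_rfl fun M'' hM'' => ?_
    · rw [hagree input (by decide), hr]
    · rw [hagree input (by decide), hs]
    · have := length_tourList_le r s (M owner) k
      rw [hout]
      omega
    · rw [hM'', hout, tourList_succ]

namespace AssignmentData

/-- The objective: the product of the two total costs. -/
def value (D : AssignmentData) (o : ℕ → ℕ) : ℕ := assignCost D.A D.r o * assignCost D.B D.r o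

/-- The conditions under which the search works: `S` bounds the total costs, and all costs are
multiples of `4`, so that a total cost is `0` as soon as it is less than `4`. -/
structure Valid (D : AssignmentData) (S : ℕ) : Prop where
  n_pos : 0 < D.n
  r_pos : 0 < D.r
  four_dvd : ∀ j ∈ Set.Icc 1 D.r, ∀ i < D.r, 4 ∣ D.A j i ∧ 4 ∣ D.B j i
  cost_le : ∀ o, IsAssignment D.r o → assignCost D.A D.r o ≤ S ∧ assignCost D.B D.r o ≤ S

/-- Words of `b` bits suffice for the search. -/
structure FitsWord (D : AssignmentData) (S b : ℕ) : Prop where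
  index_lt : 2 * D.r + 3 < 2 ^ b
  weight_lt : 4 * (12 * D.r * D.n) + 2 < 2 ^ b
  cost_lt : 2 * S + 1 < 2 ^ b
  value_lt : 2 * (S * S) + 1 < 2 ^ b

/-- The value `v` is good enough for all assignments whose two total costs the pair `p` fits. -/
def Covers (D : AssignmentData) (v : ℕ) (p : ℕ × ℕ) : Prop :=
  ∀ σ, IsAssignment D.r σ → IsGuess (4 * D.n) p.1 (assignCost D.A D.r σ) →
    IsGuess (4 * D.n) p.2 (assignCost D.B D.r σ) → D.n * v ≤ (D.n + 1) * D.value σ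

/-- The state of the search when the pairs in `G` have been tried as guesses: the best value found
so far, if there is one, is that of the tour in the output, and it covers these pairs. The search
starts with a value exceeding `2 * (S * S)`. -/
structure Record (D : AssignmentData) (S : ℕ) (G : Set (ℕ × ℕ)) (M : Mem) : Prop where
  attained : M best 0 ≤ 2 * (S * S) → ∃ o, IsAssignment D.r o ∧ D.value o = M best 0 ∧
    output M = tourList D.r D.s o D.r
  covers : ∀ p ∈ G, D.Covers (M best 0) p

variable {D : AssignmentData} {S : ℕ}

theorem weight_le (D : AssignmentData) (α β j i : ℕ) :
    D.weight α β j i ≤ 4 * (12 * D.r * D.n) := Nat.sub_le _ _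

theorem Valid.value_le (hD : D.Valid S) {o : ℕ → ℕ} (ho : IsAssignment D.r o) :
    D.value o ≤ S * S :=
  Nat.mul_le_mul (hD.cost_le o ho).1 (hD.cost_le o ho).2

theorem Covers.mono {v v' : ℕ} {p : ℕ × ℕ} (h : D.Covers v p) (hv : v' ≤ v) : D.Covers v' p :=
  fun σ hσ hα hβ => (Nat.mul_le_mul_left _ hv).trans (h σ hσ hα hβ)

theorem Valid.covers (hD : D.Valid S) {α β : ℕ} {o : ℕ → ℕ} (ho : IsAssignment D.r o)
    (hopt : ∀ σ, IsAssignment D.r σ →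
      ∑ i ∈ range D.r, D.weight α β (o i) i ≤ ∑ i ∈ range D.r, D.weight α β (σ i) i + D.r) :
    D.Covers (D.value o) (α, β) := by
  intro σ hσ hα hβ
  have hdvd : ∀ i ∈ range D.r, 4 ∣ D.A (o i) i ∧ 4 ∣ D.B (o i) i := fun i hi =>
    hD.four_dvd _ (ho.mapsTo (Finset.mem_range.1 hi)) i (Finset.mem_range.1 hi)
  refine mul_mul_sum_le_of_isGuess hD.n_pos (fun i hi => (hdvd i hi).1) (fun i hi => (hdvd i hi).2)
    hα hβ ?_
  rw [Finset.card_range]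
  exact hopt σ hσ

namespace Record

variable {G G' : Set (ℕ × ℕ)} {M M' : Mem}

theorem congr (h : D.Record S G M) (hbest : M' best = M best) (htour : M' tour = M tour) :
    D.Record S G M' where
  attained := by rw [hbest, output_congr htour]; exact h.attained
  covers := by rw [hbest]; exact h.covers

theorem anti (h : D.Record S G M) (hsub : G' ⊆ G) : D.Record S G' M where
  attained := h.attained
  covers p hp := h.covers p (hsub hp)

theorem exists_isAssignment (h : D.Record S G M) (hD : D.Valid S)
    (hG : ∀ σ, IsAssignment D.r σ → ∃ p ∈ G, IsGuess (4 * D.n) p.1 (assignCost D.A D.r σ) ∧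
      IsGuess (4 * D.n) p.2 (assignCost D.B D.r σ)) :
    ∃ o, IsAssignment D.r o ∧ output M = tourList D.r D.s o D.r ∧
      ∀ σ, IsAssignment D.r σ → D.n * D.value o ≤ (D.n + 1) * D.value σ := by
  have hbest : ∀ σ, IsAssignment D.r σ → D.n * M best 0 ≤ (D.n + 1) * D.value σ := by
    intro σ hσ
    obtain ⟨p, hp, hα, hβ⟩ := hG σ hσ
    exact h.covers p hp σ hσ hα hβ
  have hsucc : IsAssignment D.r (· + 1) := isAssignment_of_injOn
    (fun i hi => ⟨i.succ_pos, hi⟩) (add_left_injective 1).injOn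
  have := hD.n_pos
  obtain ⟨o, ho, hval, hout⟩ := h.attained <| Nat.le_of_mul_le_mul_left
    (calc D.n * M best 0 ≤ (D.n + 1) * (S * S) :=
          (hbest _ hsucc).trans (Nat.mul_le_mul_left _ (hD.value_le hsucc))
      _ ≤ (2 * D.n) * (S * S) := by gcongr; omega
      _ = D.n * (2 * (S * S)) := by ring) hD.n_pos
  exact ⟨o, ho, hout, hval ▸ hbest⟩

end Record

end AssignmentData

/-- Writes the tour belonging to the assignment to the output if it is better than all before. -/
def keepBetter : Cmd :=
  .ite (var best - var totalA * var totalB)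
    (.seq (assign best (var totalA * var totalB)) writeTour) .skip

theorem keepBetter_runs {b S : ℕ} {D : AssignmentData} {G : Set (ℕ × ℕ)} {p : ℕ × ℕ} {M : Mem}
    (hdata : M.data = D) (hD : D.Valid S) (hb : D.FitsWord S b) (ho : IsAssignment D.r (M owner))
    (hval : M totalA 0 * M totalB 0 = D.value (M owner)) (hp : D.Covers (D.value (M owner)) p)
    (hM : D.Record S G M) :
    Runs b keepBetter M (7 * D.r + 5) (D.Record S (insert p G)) := by
  have hindex := hb.index_lt
  refine Runs.ite (T := 7 * D.r + 4) (fun hguard => ?_) fun hguard => ?_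
  · replace hguard : D.value (M owner) < M best 0 := by
      simpa [hval] using Nat.sub_ne_zero_iff_lt.1 hguard
    have hwrite := writeTour_runs (b := b) (r := D.r) (s := D.s)
      (M := M.write best 0 (M totalA 0 * M totalB 0)) (congrArg AssignmentData.r hdata)
      (congrArg AssignmentData.s hdata) (fun i hi => (ho.mapsTo hi).2) (by omega)
    refine (Runs.assign_seq ?_ hwrite.framed).mono (by omega) fun M' ⟨hagree, hout⟩ => ?_
    · have := hD.value_le ho
      have := hb.value_lt
      simp only [Expr.eval_mul, eval_var, hval]
      omega
    · have hbest : M' best 0 = D.value (M owner) := by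
        rw [hagree best (by decide), Mem.write_self]
        exact hval
      refine ⟨fun _ => ⟨M owner, ho, hbest.symm, hout⟩, Set.forall_mem_insert.2 ?_⟩
      rw [hbest]
      exact ⟨hp, fun q hq => (hM.covers q hq).mono hguard.le⟩
  · replace hguard : M best 0 ≤ D.value (M owner) := by
      simpa [hval] using Nat.sub_eq_zero_iff_le.1 hguard
    refine (Runs.skip ⟨hM.attained, Set.forall_mem_insert.2 ?_⟩).mono (by omega) fun _ => id
    exact ⟨hp.mono hguard, hM.covers⟩

/-- Tries the current pair of guesses. -/
def tryGuess : Cmd := .seq auction <| .seq evaluate keepBetter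

/-- A bound for the number of steps of `tryGuess`. -/
def guessSteps (r n : ℕ) : ℕ :=
  auctionSteps r (4 * (12 * r * n)) + (4 * r + 4 + (7 * r + 5))

theorem tryGuess_runs {b S : ℕ} {D : AssignmentData} {G : Set (ℕ × ℕ)} {M : Mem}
    (hdata : M.data = D) (hD : D.Valid S) (hb : D.FitsWord S b) (hM : D.Record S G M) :
    Runs b tryGuess M (guessSteps D.r D.n) (D.Record S (insert (M guessA 0, M guessB 0) G)) := by
  have hindex := hb.index_lt
  have hcost := hb.cost_lt
  have hweight : M.weight = D.weight (M guessA 0) (M guessB 0) := by rw [Mem.weight, hdata]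
  refine (auction_runs (W := 4 * (12 * D.r * D.n)) (congrArg AssignmentData.r hdata) hD.r_pos
    (fun j i => hweight ▸ D.weight_le _ _ j i) (by omega) hb.weight_lt).framed.seq
    fun M₁ ⟨hagree₁, ho, hopt⟩ => ?_
  have hdata₁ : M₁.data = D := by rw [hagree₁.data_eq (by decide), hdata]
  obtain ⟨hA, hB⟩ := hD.cost_le _ ho
  refine (evaluate_runs hdata₁ (by omega) (by omega) (by omega)).framed.seq
    fun M₂ ⟨hagree₂, htotalA, htotalB⟩ => ?_
  have howner : M₂ owner = M₁ owner := hagree₂ owner (by decide)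
  refine keepBetter_runs ?_ hD hb ?_ ?_ ?_ (hM.congr ?_ ?_)
  · rw [hagree₂.data_eq (by decide), hdata₁]
  · rwa [howner]
  · rw [htotalA, htotalB, howner, AssignmentData.value]
  · rw [howner]
    exact hD.covers ho (hweight ▸ hopt)
  · rw [hagree₂ best (by decide), hagree₁ best (by decide)]
  · rw [hagree₂ tour (by decide), hagree₁ tour (by decide)]

/-- Runs `c` with `x` taking the values `grid (4 * n) 0, grid (4 * n) 1, …` up to the bound, where
`n` is the accuracy. -/
def gridLoop (x : ℕ) (c : Cmd) : Cmd :=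
  .seq (assign x (.lit 1)) <| .loop (var bound + .lit 1 - var x) <|
    .seq c (assign x (var x + var x / (.lit 4 * nE) + .lit 1))

theorem Runs.gridLoop {b n S L T x : ℕ} {c : Cmd} {M : Mem} {Inv : ℕ → Mem → Prop}
    (hx : x ∉ c.writes) (hinput : input ∉ x :: c.writes) (hbound : bound ∉ x :: c.writes)
    (hn : M input 0 = n) (hn₀ : 0 < n) (hS : M bound 0 = S) (hL : S < 2 ^ L)
    (hb : 2 * S + 1 < 2 ^ b) (hInv : ∀ k M' v, Inv k M' → Inv k (M'.write x 0 v)) (init : Inv 0 M)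
    (step : ∀ k M', AgreeOff (x :: c.writes) M M' → M' x 0 = grid (4 * n) k → Inv k M' →
      Runs b c M' T (Inv (k + 1))) :
    Runs b (gridLoop x c) M (4 * n * L * (T + 2) + 2)
      fun M' => ∃ k, (∀ l, grid (4 * n) l ≤ S → l < k) ∧ Inv k M' := by
  have hmono := grid_strictMono (4 * n)
  have hinputc : input ∉ c.writes := fun h => hinput (List.mem_cons_of_mem x h)
  refine (Runs.assign_seq (by simp only [Expr.eval_lit]; omega) <|
    Runs.loop_framed (k := 0) (G := 4 * n * L) (T := T + 1)
      (Inv := fun k M' => M' x 0 = grid (4 * n) k ∧ Inv k M') ?_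
      ⟨by simp [grid], hInv _ _ _ init⟩).mono (by rw [Nat.sub_zero, add_comm 1]) ?_
  · rintro k M' hagree ⟨hxk, hk⟩ hguard
    replace hagree : AgreeOff (x :: c.writes) M M' :=
      hagree.of_write.mono (by simp [Cmd.writes, RAM.assign])
    have hle : grid (4 * n) k ≤ S := by
      simp only [Expr.eval_sub, Expr.eval_add, Expr.eval_lit, eval_var, hagree bound hbound, hS,
        hxk] at hguard
      omega
    refine ⟨hmono.lt_iff_lt.1 ?_, (step k M' hagree hxk hk).framed.seq
      fun M'' ⟨hagree', hk'⟩ => ?_⟩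
    · exact hle.trans_lt (hL.trans_le (two_pow_le_grid (by omega) L))
    · have hnext : (var x + var x / (.lit 4 * nE) + .lit 1 : Expr).eval M'' =
          grid (4 * n) (k + 1) := by
        simp [hagree' x hx, hxk, hagree' input hinputc, hagree input hinput, hn, grid]
      have := Nat.div_le_self (grid (4 * n) k) (4 * n)
      refine Runs.assign ?_ ⟨by rw [hnext, Mem.write_self], hInv _ _ _ hk'⟩
      rw [hnext, grid]
      omega
  · rintro M' ⟨hagree, k, ⟨hxk, hk⟩, hguard⟩
    refine ⟨k, fun l hl => hmono.lt_iff_lt.1 ?_, hk⟩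
    replace hagree : AgreeOff (x :: c.writes) M M' :=
      hagree.of_write.mono (by simp [Cmd.writes, RAM.assign])
    simp only [Expr.eval_sub, Expr.eval_add, Expr.eval_lit, eval_var, hagree bound hbound, hS, hxk]
      at hguard
    omega

/-- Tries all second guesses with the current first guess. -/
def searchSecond : Cmd := gridLoop guessB tryGuess

theorem searchSecond_runs {b S L : ℕ} {D : AssignmentData} {G : Set (ℕ × ℕ)} {M : Mem}
    (hdata : M.data = D) (hS : M bound 0 = S) (hL : S < 2 ^ L) (hD : D.Valid S)
    (hb : D.FitsWord S b) (hM : D.Record S G M) :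
    Runs b searchSecond M (4 * D.n * L * (guessSteps D.r D.n + 2) + 2)
      (D.Record S (G ∪ {p | p.1 = M guessA 0 ∧ ∃ l, p.2 = grid (4 * D.n) l ∧ p.2 ≤ S})) := by
  refine (Runs.gridLoop (Inv := fun k => D.Record S
      (G ∪ {p | p.1 = M guessA 0 ∧ ∃ l < k, p.2 = grid (4 * D.n) l}))
    (by decide) (by decide) (by decide)
    (congrArg AssignmentData.n hdata) hD.n_pos hS hL hb.cost_lt ?_ (hM.anti ?_) ?_).mono le_rfl ?_
  · exact fun k M' v h => h.congr (Mem.write_of_ne _ _ _ (by decide))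
      (Mem.write_of_ne _ _ _ (by decide))
  · simp
  · intro k M' hagree hguess hk
    refine (tryGuess_runs ?_ hD hb hk).mono le_rfl fun M'' h => h.anti ?_
    · rw [hagree.data_eq (by decide), hdata]
    · rintro p (hp | ⟨hp, l, hl, hpl⟩)
      · exact Or.inr (Or.inl hp)
      · obtain hl | rfl := Nat.lt_succ_iff_lt_or_eq.1 hl
        · exact Or.inr (Or.inr ⟨hp, l, hl, hpl⟩)
        · exact Or.inl (Prod.ext (hp.trans (by rw [hagree guessA (by decide)]))
            (hpl.trans hguess.symm))
  · rintro M' ⟨k, hlt, h⟩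
    refine h.anti (Set.union_subset_union_right _ ?_)
    rintro p ⟨hp, l, hl, hle⟩
    exact ⟨hp, l, hlt l (hl ▸ hle), hl⟩

/-- Tries all pairs of guesses. -/
def search : Cmd := gridLoop guessA searchSecond

theorem search_runs {b S L : ℕ} {D : AssignmentData} {M : Mem} (hdata : M.data = D)
    (hS : M bound 0 = S) (hS₀ : 0 < S) (hL : S < 2 ^ L) (hD : D.Valid S) (hb : D.FitsWord S b)
    (hbest : 2 * (S * S) < M best 0) :
    Runs b search M (4 * D.n * L * (4 * D.n * L * (guessSteps D.r D.n + 2) + 4) + 2) fun M' =>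
      ∃ o, IsAssignment D.r o ∧ output M' = tourList D.r D.s o D.r ∧
        ∀ σ, IsAssignment D.r σ → D.n * D.value o ≤ (D.n + 1) * D.value σ := by
  refine (Runs.gridLoop (Inv := fun k => D.Record S
      {p | (∃ l < k, p.1 = grid (4 * D.n) l) ∧ ∃ l, p.2 = grid (4 * D.n) l ∧ p.2 ≤ S})
    (by decide) (by decide) (by decide) (congrArg AssignmentData.n hdata) hD.n_pos hS hL hb.cost_lt
    ?_ ⟨fun hle => absurd hle hbest.not_ge, by simp⟩ ?_).mono le_rfl ?_
  · exact fun k M' v h => h.congr (Mem.write_of_ne _ _ _ (by decide))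
      (Mem.write_of_ne _ _ _ (by decide))
  · intro k M' hagree hguess hk
    refine (searchSecond_runs ?_ ?_ hL hD hb hk).mono le_rfl fun M'' h => h.anti ?_
    · rw [hagree.data_eq (by decide), hdata]
    · rw [hagree bound (by decide), hS]
    · rintro p ⟨⟨l, hl, hpl⟩, hp⟩
      obtain hl | rfl := Nat.lt_succ_iff_lt_or_eq.1 hl
      · exact Or.inl ⟨⟨l, hl, hpl⟩, hp⟩
      · exact Or.inr ⟨hpl.trans hguess.symm, hp⟩
  · rintro M' ⟨k, hlt, h⟩
    refine h.exists_isAssignment hD fun σ hσ => ?_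
    obtain ⟨hA, hB⟩ := hD.cost_le σ hσ
    obtain ⟨l, hl⟩ := exists_isGuess_grid (4 * D.n) (assignCost D.A D.r σ)
    obtain ⟨m, hm⟩ := exists_isGuess_grid (4 * D.n) (assignCost D.B D.r σ)
    refine ⟨(grid (4 * D.n) l, grid (4 * D.n) m), ⟨⟨l, hlt l ?_, rfl⟩, m, rfl, ?_⟩, hl, hm⟩
    · exact hl.le_max.trans (max_le hA hS₀)
    · exact hm.le_max.trans (max_le hB hS₀)

end RAM

/-! ## Reading the input -/

namespace RAM

open Finset (range)

open Bank

section Costs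

variable (w : ℕ → ℕ)

/-- The numerator of the `q`-th rational number in the input `w`. The costs of the `m`-th edge are
the numbers `2 * m` and `2 * m + 1`. -/
def num (q : ℕ) : ℕ := w (3 + 2 * q)

/-- The denominator of the `q`-th rational number in the input `w`. -/
def den (q : ℕ) : ℕ := w (4 + 2 * q)

/-- The number of rational numbers in the input `w`: two for every edge. -/
def fractionCount : ℕ := 2 * (w 1 + w 1 * w 2)

/-- All denominators in the input `w` are positive. -/
def DenPos : Prop := ∀ q < fractionCount w, 0 < den w q

/-- A multiple of the first `k` denominators that also exceeds the first `k` numerators. -/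
def commonMultiple (k : ℕ) : ℕ := ∏ q ∈ range k, (num w q + 1) * den w q

/-- The factor that makes all costs integral; the program uses `4` times the resulting costs. -/
def scale : ℕ := commonMultiple w (fractionCount w)

/-- The integral cost of the `m`-th edge, from `a` for `c = 0` and from `b` for `c = 1`. -/
def scaledCost (c m : ℕ) : ℕ :=
  4 * num w (2 * m + c) * (scale w / den w (2 * m + c))

/-- The cost of giving the object `i` to the person `j`: that of inserting `v_j` into the `i`-th
edge of the cycle if `j ≤ s`, and that of keeping this edge otherwise. -/
def entry (c j i : ℕ) : ℕ :=
  if j ≤ w 2 then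
    scaledCost w c (w 1 + i * w 2 + (j - 1)) + scaledCost w c (w 1 + (i + 1) % w 1 * w 2 + (j - 1))
  else scaledCost w c i

/-- The assignment problem given by the input `w`. -/
def costData : AssignmentData := ⟨w 0, w 1, w 2, entry w 0, entry w 1⟩

/-- A bound on the two total costs of an assignment. -/
def costBound : ℕ := 8 * w 1 * (scale w * scale w)

end Costs

section CostBounds

variable {w : ℕ → ℕ} {c i j k m q : ℕ}

theorem commonMultiple_dvd_scale (hk : k ≤ fractionCount w) : commonMultiple w k ∣ scale w :=
  Finset.prod_dvd_prod_of_subset _ _ _ (Finset.range_subset_range.2 hk)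

theorem factor_dvd_scale (hq : q < fractionCount w) : (num w q + 1) * den w q ∣ scale w :=
  Finset.dvd_prod_of_mem (fun q => (num w q + 1) * den w q) (Finset.mem_range.2 hq)

theorem den_dvd_scale (hq : q < fractionCount w) : den w q ∣ scale w :=
  dvd_of_mul_left_dvd (factor_dvd_scale hq)

theorem scale_pos (hw : DenPos w) : 0 < scale w :=
  Finset.prod_pos fun q hq => Nat.mul_pos (Nat.succ_pos _) (hw q (Finset.mem_range.1 hq))

theorem num_le_scale (hw : DenPos w) (hq : q < fractionCount w) : num w q ≤ scale w :=
  (Nat.le_succ _).trans <|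
    Nat.le_of_dvd (scale_pos hw) (dvd_of_mul_right_dvd (factor_dvd_scale hq))

theorem scaledCost_le (hw : DenPos w) (hc : c < 2) (hm : m < w 1 + w 1 * w 2) :
    scaledCost w c m ≤ 4 * (scale w * scale w) := by
  rw [scaledCost, mul_assoc]
  gcongr
  · exact num_le_scale hw (by rw [fractionCount]; omega)
  · exact Nat.div_le_self _ _

theorem four_dvd_scaledCost : 4 ∣ scaledCost w c m := ⟨_, mul_assoc _ _ _⟩

theorem four_dvd_entry : 4 ∣ entry w c j i := by
  unfold entry
  split_ifs
  exacts [dvd_add four_dvd_scaledCost four_dvd_scaledCost, four_dvd_scaledCost]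

theorem crossIndex_lt {r s : ℕ} (hi : i < r) (hj : 1 ≤ j) (hjs : j ≤ s) :
    r + i * s + (j - 1) < r + r * s := by
  have : (i + 1) * s ≤ r * s := Nat.mul_le_mul_right _ hi
  rw [add_mul, one_mul] at this
  omega

theorem entry_le (hw : DenPos w) (hc : c < 2) (hi : i < w 1) (hj : 1 ≤ j) :
    entry w c j i ≤ 8 * (scale w * scale w) := by
  unfold entry
  split_ifs with hjs
  · have := scaledCost_le hw hc (crossIndex_lt hi hj hjs)
    have := scaledCost_le hw hc (crossIndex_lt (Nat.mod_lt (i + 1) (by omega)) hj hjs)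
    omega
  · have := scaledCost_le hw hc (m := i) (by omega)
    omega

theorem assignCost_entry_le (hw : DenPos w) (hc : c < 2) {o : ℕ → ℕ}
    (ho : IsAssignment (w 1) o) : assignCost (entry w c) (w 1) o ≤ costBound w :=
  calc assignCost (entry w c) (w 1) o ≤ (range (w 1)).card • (8 * (scale w * scale w)) :=
        Finset.sum_le_card_nsmul _ _ _ fun i hi =>
          entry_le hw hc (Finset.mem_range.1 hi) (ho.mapsTo (Finset.mem_range.1 hi)).1
    _ = costBound w := by rw [Finset.card_range, smul_eq_mul, costBound]; ring

theorem costData_valid (hw : DenPos w) (hn : 0 < w 0) (hr : 0 < w 1) :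
    (costData w).Valid (costBound w) where
  n_pos := hn
  r_pos := hr
  four_dvd _ _ _ _ := ⟨four_dvd_entry, four_dvd_entry⟩
  cost_le _ ho := ⟨assignCost_entry_le hw (by decide) ho, assignCost_entry_le hw (by decide) ho⟩

end CostBounds

namespace AssignmentData

/-- Two assignment problems have the same parameters and the same relevant costs. -/
structure Agrees (D D' : AssignmentData) : Prop where
  n_eq : D.n = D'.n
  r_eq : D.r = D'.r
  s_eq : D.s = D'.s
  A_eq : ∀ j ∈ Set.Icc 1 D.r, ∀ i < D.r, D.A j i = D'.A j i
  B_eq : ∀ j ∈ Set.Icc 1 D.r, ∀ i < D.r, D.B j i = D'.B j i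

namespace Agrees

variable {D D' : AssignmentData} {S b : ℕ} {o : ℕ → ℕ}

theorem assignCost_eq (h : D.Agrees D') (ho : IsAssignment D.r o) :
    assignCost D.A D.r o = assignCost D'.A D'.r o ∧
      assignCost D.B D.r o = assignCost D'.B D'.r o := by
  rw [← h.r_eq]
  exact ⟨Finset.sum_congr rfl fun i hi =>
      h.A_eq _ (ho.mapsTo (Finset.mem_range.1 hi)) _ (Finset.mem_range.1 hi),
    Finset.sum_congr rfl fun i hi =>
      h.B_eq _ (ho.mapsTo (Finset.mem_range.1 hi)) _ (Finset.mem_range.1 hi)⟩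

theorem value_eq (h : D.Agrees D') (ho : IsAssignment D.r o) : D.value o = D'.value o := by
  rw [value, value, (h.assignCost_eq ho).1, (h.assignCost_eq ho).2]

theorem valid (h : D.Agrees D') (hD' : D'.Valid S) : D.Valid S where
  n_pos := h.n_eq ▸ hD'.n_pos
  r_pos := h.r_eq ▸ hD'.r_pos
  four_dvd j hj i hi := by
    rw [h.A_eq j hj i hi, h.B_eq j hj i hi]
    rw [h.r_eq] at hj hi
    exact hD'.four_dvd j hj i hi
  cost_le o ho := by
    rw [(h.assignCost_eq ho).1, (h.assignCost_eq ho).2]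
    rw [h.r_eq] at ho
    exact hD'.cost_le o ho

theorem fitsWord (h : D.Agrees D') (hD' : D'.FitsWord S b) : D.FitsWord S b where
  index_lt := h.r_eq ▸ hD'.index_lt
  weight_lt := by
    rw [h.r_eq, h.n_eq]
    exact hD'.weight_lt
  cost_lt := hD'.cost_lt
  value_lt := hD'.value_lt

end Agrees

end AssignmentData

/-- The `q`-th numerator in the input. -/
def numE (q : Expr) : Expr := .get input (.lit 3 + .lit 2 * q)

/-- The `q`-th denominator in the input. -/
def denE (q : Expr) : Expr := .get input (.lit 4 + .lit 2 * q)

/-- Computes the scale. -/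
def multiply : Cmd :=
  .seq (assign multiple (.lit 1)) <| forLoop counter (.lit 0) (.lit 2 * (rE + rE * sE)) <|
    assign multiple (var multiple * ((numE (var counter) + .lit 1) * denE (var counter)))

theorem multiply_runs {b : ℕ} {w : ℕ → ℕ} {M : Mem} (hM : M input = w) (hw : DenPos w)
    (hb : fractionCount w < 2 ^ b) (hscale : scale w < 2 ^ b) :
    Runs b multiply M (3 * fractionCount w + 3) fun M' => M' multiple 0 = scale w := by
  refine (Runs.assign_seq (Nat.lt_of_le_of_lt (scale_pos hw) hscale) <|
    Runs.forLoop (T := 1) (k₀ := 0) (n := fractionCount w)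
      (Inv := fun k M' => M' multiple 0 = commonMultiple w k) (by decide) rfl
      (Nat.zero_le _) hb (fun M' hM' => ?_) (fun k M' v hk => ?_) ?_ ?_).mono (by omega)
    fun _ => id
  · simp [hM' input (by decide), Mem.write_of_ne, hM, fractionCount]
  · rwa [Mem.write_of_ne _ _ _ (by decide)]
  · simp [commonMultiple]
  · intro k M' hagree hcounter _ hk hmul
    have hinput : M' input = w := (hagree.of_write input (by decide)).trans hM
    have heval : (var multiple * ((numE (var counter) + .lit 1) * denE (var counter)) : Expr).eval
        M' = commonMultiple w (k + 1) := by
      simp [numE, denE, hinput, hcounter, hmul, commonMultiple, Finset.prod_range_succ, num, den]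
    refine Runs.assign ?_ (by rw [heval, Mem.write_self])
    rw [heval]
    exact (Nat.le_of_dvd (scale_pos hw) (commonMultiple_dvd_scale hk)).trans_lt hscale

/-- The integral cost of the edge with the number `m`. -/
def scaledCostE (c : ℕ) (m : Expr) : Expr :=
  .lit 4 * numE (.lit 2 * m + .lit c) * (var multiple / denE (.lit 2 * m + .lit c))

/-- The row of the current matrix entry. -/
def rowE : Expr := var counter / rE

/-- The column of the current matrix entry. -/
def colE : Expr := modE (var counter) rE

/-- The costs of the edges that join `v_j` to `u_i`, where `j` is the current row. -/
def crossCostE (c : ℕ) (i : Expr) : Expr := scaledCostE c (rE + i * sE + (rowE - .lit 1))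

/-- Computes the current entry of a cost matrix and stores it in the bank `x`. -/
def fillStep (x c : ℕ) : Cmd :=
  .ite (sE + .lit 1 - rowE)
    (.set x (var counter) (crossCostE c colE + crossCostE c (modE (colE + .lit 1) rE)))
    (.set x (var counter) (scaledCostE c colE))

theorem fillStep_runs {b c x k : ℕ} {w : ℕ → ℕ} {M : Mem} (hM : M input = w)
    (hscale : M multiple 0 = scale w) (hk : M counter 0 = k)
    (hb : entry w c (k / w 1) (k % w 1) < 2 ^ b) :
    Runs b (fillStep x c) M 2 (· = M.write x k (entry w c (k / w 1) (k % w 1))) := by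
  have hcost (m : Expr) : (scaledCostE c m).eval M = scaledCost w c (m.eval M) := by
    simp [scaledCostE, numE, denE, scaledCost, num, den, hM, hscale]
  refine Runs.ite (T := 1) (fun hguard => ?_) fun hguard => ?_ <;>
    simp only [rowE, Expr.eval_sub, Expr.eval_add, Expr.eval_div, Expr.eval_get, Expr.eval_lit,
      eval_var, hM, hk] at hguard
  · have heval : (crossCostE c colE + crossCostE c (modE (colE + .lit 1) rE)).eval M =
        entry w c (k / w 1) (k % w 1) := by
      rw [entry, if_pos (by omega)]
      simp [crossCostE, hcost, rowE, colE, hM, hk]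
    exact Runs.set (heval ▸ hb) (by rw [heval, eval_var, hk])
  · have heval : (scaledCostE c colE).eval M = entry w c (k / w 1) (k % w 1) := by
      rw [entry, if_neg (by omega), hcost]
      simp [colE, hM, hk]
    exact Runs.set (heval ▸ hb) (by rw [heval, eval_var, hk])

/-- Computes the two cost matrices. -/
def fill : Cmd :=
  forLoop counter rE (rE * rE + rE) <| .seq (fillStep costA 0) (fillStep costB 1)

/-- The cells `r, …, k - 1` of both cost matrices, with `r` columns, have been computed. -/
def FilledUpTo (w : ℕ → ℕ) (k : ℕ) (M : Mem) : Prop :=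
  ∀ l ∈ Set.Ico (w 1) k,
    M costA l = entry w 0 (l / w 1) (l % w 1) ∧ M costB l = entry w 1 (l / w 1) (l % w 1)

theorem FilledUpTo.agrees {w : ℕ → ℕ} {M : Mem} (hM : M input = w)
    (h : FilledUpTo w (w 1 * w 1 + w 1) M) : M.data.Agrees (costData w) := by
  subst hM
  have hcell (j) (hj : j ∈ Set.Icc 1 (M input 1)) (i) (hi : i < M input 1) :
      M costA (j * M input 1 + i) = entry (M input) 0 j i ∧
        M costB (j * M input 1 + i) = entry (M input) 1 j i := by
    have hdiv : (j * M input 1 + i) / M input 1 = j := by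
      rw [mul_comm, Nat.mul_add_div (by omega), Nat.div_eq_of_lt hi, add_zero]
    have hmod : (j * M input 1 + i) % M input 1 = i := by
      rw [mul_comm, Nat.mul_add_mod, Nat.mod_eq_of_lt hi]
    have hlower : 1 * M input 1 ≤ j * M input 1 := Nat.mul_le_mul_right _ hj.1
    have hupper : j * M input 1 ≤ M input 1 * M input 1 := Nat.mul_le_mul_right _ hj.2
    have := h (j * M input 1 + i) ⟨by omega, by omega⟩
    rwa [hdiv, hmod] at this
  exact ⟨rfl, rfl, rfl, fun j hj i hi => (hcell j hj i hi).1, fun j hj i hi => (hcell j hj i hi).2⟩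

theorem fill_runs {b : ℕ} {w : ℕ → ℕ} {M : Mem} (hM : M input = w)
    (hscale : M multiple 0 = scale w) (hw : DenPos w) (hr : 0 < w 1)
    (hindex : w 1 * w 1 + w 1 < 2 ^ b) (hb : 8 * (scale w * scale w) < 2 ^ b) :
    Runs b fill M (6 * (w 1 * w 1) + 2) fun M' => M'.data.Agrees (costData w) := by
  refine (Runs.forLoop (T := 4) (k₀ := w 1) (n := w 1 * w 1 + w 1)
    (Inv := fun k M' => FilledUpTo w k M') (by decide) (by simp [hM]) (by omega) hindex
    (fun M' hM' => by simp [hM' input (by decide), hM]) (fun k M' v hk => ?_)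
    (fun l hl => absurd hl.1 hl.2.not_ge) ?_).framed.mono (by omega)
    fun M' ⟨hagree, h⟩ => h.agrees ((hagree input (by decide)).trans hM)
  · simpa [FilledUpTo, Mem.write_of_ne] using hk
  · intro k M' hagree hcounter hrk _ hfilled
    have hinput : M' input = w := (hagree input (by decide)).trans hM
    have hmult : M' multiple 0 = scale w := by rw [hagree multiple (by decide), hscale]
    have hentry (c) (hc : c < 2) : entry w c (k / w 1) (k % w 1) < 2 ^ b :=
      (entry_le hw hc (Nat.mod_lt k hr) ((Nat.one_le_div_iff hr).2 hrk)).trans_lt hb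
    refine Runs.seq (T₁ := 2) (T₂ := 2)
      (fillStep_runs hinput hmult hcounter (hentry 0 (by decide))) fun M₁ hM₁ => ?_
    subst hM₁
    refine (fillStep_runs (w := w) (k := k) ?_ ?_ ?_ (hentry 1 (by decide))).mono le_rfl ?_
    iterate 3 rwa [Mem.write_of_ne _ _ _ (by decide)]
    rintro M₂ rfl l ⟨hrl, hlk⟩
    obtain hlk | rfl := Nat.lt_succ_iff_lt_or_eq.1 hlk
    · simpa [Mem.write_apply, hlk.ne] using hfilled l ⟨hrl, hlk⟩
    · simp [Mem.write_apply]

/-! ## The approximation scheme -/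

/-- The approximation scheme: makes the costs integral, sets up the assignment problem and searches
over the guesses. -/
def scheme : Cmd :=
  .seq multiply <| .seq fill <|
    .seq (assign bound (.lit 8 * rE * (var multiple * var multiple))) <|
      .seq (assign best (.lit 2 * (var bound * var bound) + .lit 1)) search

/-- A bound on the number of steps of the scheme. -/
def schemeSteps (r s n L : ℕ) : ℕ :=
  3 * (2 * (r + r * s)) + 3 + (6 * (r * r) + 2 + (1 + (1 +
    (4 * n * L * (4 * n * L * (guessSteps r n + 2) + 4) + 2))))

theorem scheme_runs {b L : ℕ} {w : ℕ → ℕ} {M : Mem} (hM : M input = w) (hn : 0 < w 0)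
    (hr : 0 < w 1) (hw : DenPos w) (hL : costBound w < 2 ^ L) (hcount : fractionCount w < 2 ^ b)
    (hindex : w 1 * w 1 + w 1 < 2 ^ b) (hb : (costData w).FitsWord (costBound w) b) :
    Runs b scheme M (schemeSteps (w 1) (w 2) (w 0) L) fun M' =>
      ∃ o, IsAssignment (w 1) o ∧ output M' = tourList (w 1) (w 2) o (w 1) ∧
        ∀ σ, IsAssignment (w 1) σ →
          w 0 * (costData w).value o ≤ (w 0 + 1) * (costData w).value σ := by
  have hcost := hb.cost_lt
  have hvalue := hb.value_lt
  have hscale := Nat.le_mul_self (scale w)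
  have hbound : 8 * (scale w * scale w) ≤ costBound w := by
    rw [costBound, mul_right_comm]
    exact Nat.le_mul_of_pos_right _ hr
  have hpos := scale_pos hw
  refine (multiply_runs hM hw hcount (by omega)).framed.seq fun M₁ ⟨hagree₁, hscale₁⟩ => ?_
  have hM₁ : M₁ input = w := (hagree₁ input (by decide)).trans hM
  refine (fill_runs hM₁ hscale₁ hw hr hindex (by omega)).framed.seq
    fun M₂ ⟨hagree₂, hdata₂⟩ => ?_
  have hM₂ : M₂ input = w := (hagree₂ input (by decide)).trans hM₁
  have heval : (.lit 8 * rE * (var multiple * var multiple) : Expr).eval M₂ = costBound w := by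
    simp [hM₂, hagree₂ multiple (by decide), hscale₁, costBound]
  refine Runs.assign_seq (by omega) (Runs.assign_seq (by simpa [heval] using hvalue) ?_)
  rw [heval]
  set N := (M₂.write bound 0 (costBound w)).write best 0 _ with hN
  have hagree : AgreeOff [bound, best] M₂ N := (AgreeOff.refl _ N).of_write.of_write
  have hdata : N.data.Agrees (costData w) := by rwa [hagree.data_eq (by decide)]
  refine (search_runs rfl ?_ ?_ hL (hdata.valid (costData_valid hw hn hr)) (hdata.fitsWord hb)
    ?_).mono (by rw [hdata.r_eq, hdata.n_eq]; rfl) fun M' ⟨o, ho, hout, hopt⟩ => ?_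
  · simp [hN, Mem.write_of_ne]
  · omega
  · simp [hN]
  · replace hopt (σ) (hσ : IsAssignment (w 1) σ) :
        w 0 * (costData w).value o ≤ (w 0 + 1) * (costData w).value σ := by
      have h := hopt σ (hdata.r_eq ▸ hσ)
      rwa [hdata.value_eq ho, hdata.value_eq (hdata.r_eq ▸ hσ), hdata.n_eq] at h
    rw [hdata.r_eq] at ho
    rw [hdata.r_eq, hdata.s_eq] at hout
    exact ⟨o, ho, hout, hopt⟩

end RAM

/-! ## Matching edge ejection tours -/

namespace MEE

variable {r s : ℕ}

theorem isHamiltonianCycle_of_nodup_of_mem {V : Type*} [Fintype V] [DecidableEq V]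
    {G : SimpleGraph V} {u : V} {p : G.Walk u u} (hcard : 3 ≤ Fintype.card V)
    (hnodup : p.support.tail.Nodup) (hmem : ∀ v, v ∈ p.support.tail) : p.IsHamiltonianCycle := by
  have hlength : p.length = Fintype.card V := by
    rw [← Finset.card_univ, ← Finset.eq_univ_iff_forall.2 fun v => List.mem_toFinset.2 (hmem v),
      List.toFinset_card_of_nodup hnodup, List.length_tail, SimpleGraph.Walk.length_support,
      Nat.add_sub_cancel]
  have hnil : ¬ p.Nil := by
    rw [← SimpleGraph.Walk.length_eq_zero_iff]
    omega
  refine SimpleGraph.Walk.isHamiltonianCycle_iff_isCycle_and_length_eq.2 ⟨?_, hlength⟩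
  rw [SimpleGraph.Walk.isCycle_iff_isPath_tail_and_le_length, SimpleGraph.Walk.isPath_def,
    SimpleGraph.Walk.support_tail_of_not_nil _ hnil]
  exact ⟨hnodup, hlength ▸ hcard⟩

theorem val_finRotate (i : Fin r) : (finRotate r i : ℕ) = (i + 1) % r := by
  cases r with
  | zero => exact i.elim0
  | succ n => simp [finRotate_apply, Fin.val_add]

theorem finRotate_finRotate_ne (hr : 3 ≤ r) (i : Fin r) : finRotate r (finRotate r i) ≠ i := by
  intro h
  have hval : (i + 2 : ℕ) ≡ i + 0 [MOD r] := by
    rw [Nat.ModEq, add_zero, Nat.mod_eq_of_lt i.isLt, ← add_assoc (i : ℕ) 1 1, ← Nat.mod_add_mod,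
      ← val_finRotate, ← val_finRotate, h]
  have hdvd := (Nat.modEq_zero_iff_dvd).1 (Nat.ModEq.add_left_cancel' _ hval)
  exact absurd (Nat.le_of_dvd two_pos hdvd) (by omega)

theorem finRotate_ne (hr : 3 ≤ r) (i : Fin r) : finRotate r i ≠ i := fun h =>
  finRotate_finRotate_ne hr i (by rw [h, h])

theorem cycEdge_injective (hr : 3 ≤ r) : Function.Injective (cycEdge r s) := by
  intro i i' h
  simp only [cycEdge, Sym2.eq_iff, Sum.inl.injEq] at h
  obtain ⟨h, -⟩ | ⟨rfl, h⟩ := h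
  · exact h
  · exact absurd h (finRotate_finRotate_ne hr i')

theorem cycEdge_mem_edgeSet (hr : 3 ≤ r) (i : Fin r) : cycEdge r s i ∈ (graph r s).edgeSet := by
  rw [graph, SimpleGraph.edgeSet_fromEdgeSet]
  exact ⟨Or.inl ⟨i, rfl⟩, by simpa [cycEdge] using (finRotate_ne hr i).symm⟩

theorem crossEdge_mem_edgeSet (i : Fin r) (j : Fin s) : crossEdge i j ∈ (graph r s).edgeSet := by
  rw [graph, SimpleGraph.edgeSet_fromEdgeSet]
  exact ⟨Or.inr ⟨i, j, rfl⟩, by simp [crossEdge]⟩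

section Segments

variable (π : Fin s ↪ Fin r)

/-- The edges of the tour between `u_i` and `u_{i+1}`. -/
noncomputable def segmentEdges (i : Fin r) : List (Sym2 (Vert r s)) :=
  match Function.partialInv π i with
  | some j => [crossEdge i j, crossEdge (finRotate r i) j]
  | none => [cycEdge r s i]

/-- The vertices of the tour after `u_i`, up to `u_{i+1}`. -/
noncomputable def segmentVerts (i : Fin r) : List (Vert r s) :=
  match Function.partialInv π i with
  | some j => [Sum.inr j, Sum.inl (finRotate r i)]
  | none => [Sum.inl (finRotate r i)]

theorem segmentEdges_apply (j : Fin s) :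
    segmentEdges π (π j) = [crossEdge (π j) j, crossEdge (finRotate r (π j)) j] := by
  rw [segmentEdges, Function.partialInv_left π.injective]

theorem segmentVerts_apply (j : Fin s) :
    segmentVerts π (π j) = [Sum.inr j, Sum.inl (finRotate r (π j))] := by
  rw [segmentVerts, Function.partialInv_left π.injective]

variable {π} {i : Fin r}

theorem partialInv_eq_none (h : ∀ j, π j ≠ i) : Function.partialInv π i = none :=
  Option.eq_none_iff_forall_ne_some.2 fun j hj => h j ((π.injective.isPartialInv j i).1 hj)

theorem segmentEdges_of_ne (h : ∀ j, π j ≠ i) : segmentEdges π i = [cycEdge r s i] := by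
  rw [segmentEdges, partialInv_eq_none h]

theorem segmentVerts_of_ne (h : ∀ j, π j ≠ i) :
    segmentVerts π i = [Sum.inl (finRotate r i)] := by
  rw [segmentVerts, partialInv_eq_none h]

theorem mem_segmentEdges {e : Sym2 (Vert r s)} :
    e ∈ segmentEdges π i ↔ ((∀ j, π j ≠ i) ∧ e = cycEdge r s i) ∨
      ∃ j, π j = i ∧ (e = crossEdge i j ∨ e = crossEdge (finRotate r i) j) := by
  obtain ⟨j, rfl⟩ | h := em (∃ j, π j = i)
  · simp [segmentEdges_apply]
  · push Not at h
    simp [segmentEdges_of_ne h, h]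

theorem mem_segmentVerts {v : Vert r s} :
    v ∈ segmentVerts π i ↔ v = Sum.inl (finRotate r i) ∨ ∃ j, π j = i ∧ v = Sum.inr j := by
  obtain ⟨j, rfl⟩ | h := em (∃ j, π j = i)
  · simp [segmentVerts_apply, or_comm]
  · push Not at h
    simp [segmentVerts_of_ne h, h]

theorem nodup_segmentVerts : (segmentVerts π i).Nodup := by
  unfold segmentVerts
  split <;> simp

variable (π)

theorem nodup_flatMap_segmentVerts : ((List.finRange r).flatMap (segmentVerts π)).Nodup := by
  refine List.nodup_flatMap.2 ⟨fun i _ => nodup_segmentVerts, (List.nodup_finRange r).imp ?_⟩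
  intro i i' hne v hv hv'
  rw [mem_segmentVerts] at hv hv'
  obtain rfl | ⟨j, rfl, rfl⟩ := hv <;> obtain hv' | ⟨j', rfl, hv'⟩ := hv'
  · exact hne ((finRotate r).injective (Sum.inl.inj hv'))
  · exact Sum.inl_ne_inr hv'
  · exact Sum.inr_ne_inl hv'
  · exact hne (congrArg π (Sum.inr.inj hv'))

theorem mem_flatMap_segmentVerts (v : Vert r s) :
    v ∈ (List.finRange r).flatMap (segmentVerts π) := by
  simp only [List.mem_flatMap, List.mem_finRange, true_and, mem_segmentVerts]
  obtain i | j := v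
  · exact ⟨(finRotate r).symm i, Or.inl (by rw [Equiv.apply_symm_apply])⟩
  · exact ⟨π j, Or.inr ⟨j, rfl, rfl⟩⟩

theorem toFinset_flatMap_segmentEdges (hr : 3 ≤ r) :
    ((List.finRange r).flatMap (segmentEdges π)).toFinset = ejectInsert π := by
  ext e
  simp only [List.mem_toFinset, List.mem_flatMap, List.mem_finRange, true_and, mem_segmentEdges,
    ejectInsert, Finset.mem_union, Finset.mem_sdiff, Finset.mem_image, Finset.mem_univ,
    Finset.mem_biUnion, Finset.mem_insert, Finset.mem_singleton]
  constructor
  · rintro ⟨i, ⟨h, rfl⟩ | ⟨j, rfl, h⟩⟩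
    · exact Or.inl ⟨⟨i, rfl⟩, fun ⟨j, hj⟩ => h j (cycEdge_injective hr hj)⟩
    · exact Or.inr ⟨j, h⟩
  · rintro (⟨⟨i, rfl⟩, h⟩ | ⟨j, h⟩)
    · exact ⟨i, Or.inl ⟨fun j hj => h ⟨j, congrArg _ hj⟩, rfl⟩⟩
    · exact ⟨π j, Or.inr ⟨j, rfl, h⟩⟩

end Segments

theorem exists_segmentWalk (hr : 3 ≤ r) (π : Fin s ↪ Fin r) (i : Fin r) :
    ∃ p : (graph r s).Walk (Sum.inl i) (Sum.inl (finRotate r i)),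
      p.edges = segmentEdges π i ∧ p.support.tail = segmentVerts π i := by
  obtain ⟨j, rfl⟩ | h := em (∃ j, π j = i)
  · have hleft : (graph r s).Adj (Sum.inl (π j)) (Sum.inr j) := crossEdge_mem_edgeSet _ _
    have hright : (graph r s).Adj (Sum.inl (finRotate r (π j))) (Sum.inr j) :=
      crossEdge_mem_edgeSet _ _
    refine ⟨.cons hleft (.cons hright.symm .nil), ?_, ?_⟩
    · simp [segmentEdges_apply, crossEdge, Sym2.eq_swap]
    · simp [segmentVerts_apply]
  · push Not at h
    have hadj : (graph r s).Adj (Sum.inl i) (Sum.inl (finRotate r i)) := cycEdge_mem_edgeSet hr i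
    refine ⟨.cons hadj .nil, ?_, ?_⟩
    · simp [segmentEdges_of_ne h, cycEdge]
    · simp [segmentVerts_of_ne h]

/-- The index of the vertex `u_k` of the cycle, where `k` is counted from `0` and modulo `r`. -/
def cycIndex (hr : 3 ≤ r) (k : ℕ) : Fin r := ⟨k % r, Nat.mod_lt _ (by omega)⟩

theorem finRotate_cycIndex (hr : 3 ≤ r) (k : ℕ) :
    finRotate r (cycIndex hr k) = cycIndex hr (k + 1) := by
  ext
  rw [val_finRotate]
  simp [cycIndex]

theorem map_cycIndex_range (hr : 3 ≤ r) : (List.range r).map (cycIndex hr) = List.finRange r := by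
  refine List.ext_getElem (by simp) fun k hk _ => ?_
  rw [List.length_map, List.length_range] at hk
  ext
  simp [cycIndex, Nat.mod_eq_of_lt hk]

theorem exists_prefixWalk (hr : 3 ≤ r) (π : Fin s ↪ Fin r) (k : ℕ) :
    ∃ p : (graph r s).Walk (Sum.inl (cycIndex hr 0)) (Sum.inl (cycIndex hr k)),
      p.edges = ((List.range k).map (cycIndex hr)).flatMap (segmentEdges π) ∧
        p.support.tail = ((List.range k).map (cycIndex hr)).flatMap (segmentVerts π) := by
  induction k with
  | zero => exact ⟨.nil, by simp⟩
  | succ k ih =>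
    obtain ⟨p, hpedges, hpverts⟩ := ih
    obtain ⟨q, hqedges, hqverts⟩ := exists_segmentWalk hr π (cycIndex hr k)
    refine ⟨p.append (q.copy rfl (congrArg Sum.inl (finRotate_cycIndex hr k))), ?_, ?_⟩
    · simp [hpedges, hqedges, List.range_succ]
    · simp [SimpleGraph.Walk.tail_support_append, hpverts, hqverts, List.range_succ]

theorem exists_isHamiltonianCycle (hr : 3 ≤ r) (π : Fin s ↪ Fin r) :
    ∃ (u : Vert r s) (p : (graph r s).Walk u u), p.IsHamiltonianCycle ∧
      p.edges = (List.finRange r).flatMap (segmentEdges π) ∧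
        p.support.tail = (List.finRange r).flatMap (segmentVerts π) := by
  obtain ⟨p, hedges, hverts⟩ := exists_prefixWalk hr π r
  rw [map_cycIndex_range] at hedges hverts
  have hclosed : cycIndex hr r = cycIndex hr 0 := by simp [cycIndex]
  let q := p.copy rfl (congrArg Sum.inl hclosed)
  have hqedges : q.edges = (List.finRange r).flatMap (segmentEdges π) := by simpa [q] using hedges
  have hqverts : q.support.tail = (List.finRange r).flatMap (segmentVerts π) := by
    simpa [q] using hverts
  have hq : q.IsHamiltonianCycle := isHamiltonianCycle_of_nodup_of_mem (by simp; omega)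
    (hqverts ▸ nodup_flatMap_segmentVerts π) fun v => hqverts ▸ mem_flatMap_segmentVerts π v
  exact ⟨_, q, hq, hqedges, hqverts⟩

theorem ejectInsert_mem_tours (hr : 3 ≤ r) (π : Fin s ↪ Fin r) : ejectInsert π ∈ tours r s := by
  obtain ⟨u, p, hp, hedges, -⟩ := exists_isHamiltonianCycle hr π
  exact ⟨⟨u, p, hp, by rw [hedges, toFinset_flatMap_segmentEdges π hr]⟩, π, rfl⟩

theorem describes_ejectInsert (hr : 3 ≤ r) (π : Fin s ↪ Fin r) :
    Describes (((List.finRange r).flatMap (segmentVerts π)).map vertNum) (ejectInsert π) := by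
  obtain ⟨u, p, hp, hedges, hverts⟩ := exists_isHamiltonianCycle hr π
  exact ⟨u, p, hp, by rw [hedges, toFinset_flatMap_segmentEdges π hr], by rw [hverts]⟩

theorem sum_ejectInsert {R : Type*} [AddCommMonoid R] (hr : 3 ≤ r) (π : Fin s ↪ Fin r)
    (f : Sym2 (Vert r s) → R) :
    ∑ e ∈ ejectInsert π, f e = ∑ i, ((segmentEdges π i).map f).sum := by
  obtain ⟨u, p, hp, hedges, -⟩ := exists_isHamiltonianCycle hr π
  have hnodup := hp.isCycle.edges_nodup
  rw [hedges] at hnodup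
  rw [← toFinset_flatMap_segmentEdges π hr, List.sum_toFinset _ hnodup, List.map_flatMap,
    List.flatMap_def, List.sum_flatten, List.map_map, ← List.sum_toFinset _ (List.nodup_finRange r)]
  simp

/-! ## Tours as assignments -/

/-- The assignment `o` gives the object `i` to the person of `v_j`, numbered `j + 1`, precisely if
`π` inserts `v_j` into the `i`-th edge of the cycle. -/
def Represents (π : Fin s ↪ Fin r) (o : ℕ → ℕ) : Prop :=
  ∀ (i : Fin r) (j : Fin s), o i = j + 1 ↔ π j = i

theorem exists_represents {o : ℕ → ℕ} (hs : s ≤ r) (ho : IsAssignment r o) :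
    ∃ π : Fin s ↪ Fin r, Represents π o := by
  have hsurj (j : Fin s) : ∃ i : Fin r, o i = j + 1 := by
    obtain ⟨i, hi, hoi⟩ := ho.surjOn (show (j + 1 : ℕ) ∈ Set.Icc 1 r from ⟨by omega, by omega⟩)
    exact ⟨⟨i, hi⟩, hoi⟩
  choose f hf using hsurj
  refine ⟨⟨f, fun j j' hj => Fin.ext ?_⟩, fun i j => ⟨fun h => Fin.ext ?_, ?_⟩⟩
  · exact Nat.succ_injective ((hf j).symm.trans (hj ▸ hf j'))
  · exact ho.injOn (f j).isLt i.isLt ((hf j).trans h.symm)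
  · rintro rfl
    exact hf j

theorem exists_isAssignment_represents (hs : s ≤ r) (π : Fin s ↪ Fin r) :
    ∃ o, IsAssignment r o ∧ Represents π o := by
  have := Equiv.Perm.isMultiplyPretransitive (Fin r) s
  obtain ⟨g, rfl⟩ := MulAction.exists_smul_eq (Equiv.Perm (Fin r)) (Fin.castLEEmb hs) π
  let o (i : ℕ) : ℕ := if h : i < r then (g.symm ⟨i, h⟩ : ℕ) + 1 else 0
  have ho (i : Fin r) : o i = g.symm i + 1 := dif_pos i.isLt
  refine ⟨o, isAssignment_of_injOn (fun i hi => ?_) fun i hi i' hi' h => ?_, fun i j => ?_⟩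
  · rw [ho ⟨i, hi⟩]
    exact ⟨Nat.succ_pos _, (g.symm ⟨i, hi⟩).isLt⟩
  · rw [ho ⟨i, hi⟩, ho ⟨i', hi'⟩, add_left_inj] at h
    exact congrArg Fin.val (g.symm.injective (Fin.ext h))
  · have hsymm : g.symm i = Fin.castLE hs j ↔ g (Fin.castLE hs j) = i := by
      rw [g.symm_apply_eq, eq_comm]
    rw [ho i, add_left_inj]
    exact Fin.ext_iff.symm.trans hsymm

namespace Represents

variable {π : Fin s ↪ Fin r} {o : ℕ → ℕ} {i : Fin r}

theorem exists_eq_of_le (h : Represents π o) (ho : IsAssignment r o) (hi : o i ≤ s) :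
    ∃ j : Fin s, π j = i ∧ o i = j + 1 := by
  have hpos : 1 ≤ o i := (ho.mapsTo i.isLt).1
  have hj : o i = (⟨o i - 1, by omega⟩ : Fin s) + 1 := (Nat.sub_add_cancel hpos).symm
  exact ⟨_, (h i _).1 hj, hj⟩

theorem ne_of_lt (h : Represents π o) (hi : s < o i) (j : Fin s) : π j ≠ i := by
  intro hj
  have := (h i j).2 hj
  omega

theorem tourStep_eq (h : Represents π o) (ho : IsAssignment r o) (i : Fin r) :
    RAM.tourStep r s (o i) i = (segmentVerts π i).map vertNum := by
  obtain hi | hi := le_or_gt (o i) s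
  · obtain ⟨j, rfl, hj⟩ := h.exists_eq_of_le ho hi
    rw [hj] at hi
    simp [segmentVerts_apply, hj, RAM.tourStep, hi, vertNum, val_finRotate, -finRotate_apply]
  · simp [segmentVerts_of_ne (h.ne_of_lt hi), RAM.tourStep, hi, vertNum, val_finRotate,
      -finRotate_apply]

theorem tourList_eq (h : Represents π o) (ho : IsAssignment r o) :
    RAM.tourList r s o r = ((List.finRange r).flatMap (segmentVerts π)).map vertNum := by
  rw [RAM.tourList, List.map_flatMap, ← List.map_coe_finRange_eq_range, List.flatMap_map]
  exact List.flatMap_congr fun i _ => h.tourStep_eq ho i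

end Represents

end MEE

/-! ## The encoding of instances -/

namespace MEE

variable {r s : ℕ}

theorem getElem?_flatMap_of_length_eq {α β : Type*} {f : α → List β} {n c : ℕ} (hc : c < n)
    (l : List α) (hf : ∀ a ∈ l, (f a).length = n) (i : ℕ) :
    (l.flatMap f)[n * i + c]? = l[i]?.bind fun a => (f a)[c]? := by
  induction l generalizing i with
  | nil => simp
  | cons a l ih =>
    obtain ⟨ha, hl⟩ := List.forall_mem_cons.1 hf
    rw [List.flatMap_cons]
    cases i with
    | zero => rw [mul_zero, zero_add, List.getElem?_append_left (ha ▸ hc)]; rfl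
    | succ i =>
      rw [mul_add, mul_one, add_right_comm, List.getElem?_append_right (by omega), ha,
        Nat.add_sub_cancel, ih hl, List.getElem?_cons_succ]

/-- The edges of the graph in the order of the encoding. -/
def edgeList (r s : ℕ) : List (Sym2 (Vert r s)) :=
  (List.finRange r).map (cycEdge r s) ++
    (List.finRange r).flatMap fun i => (List.finRange s).map (crossEdge i)

theorem length_edgeList : (edgeList r s).length = r + r * s := by
  simp [edgeList, List.length_flatMap]

theorem mem_edgeSet_of_mem_edgeList (hr : 3 ≤ r) {e : Sym2 (Vert r s)} (he : e ∈ edgeList r s) :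
    e ∈ (graph r s).edgeSet := by
  simp only [edgeList, List.mem_append, List.mem_map, List.mem_flatMap, List.mem_finRange,
    true_and] at he
  obtain ⟨i, rfl⟩ | ⟨i, j, rfl⟩ := he
  · exact cycEdge_mem_edgeSet hr i
  · exact crossEdge_mem_edgeSet i j

theorem edgeList_cycEdge (i : Fin r) : (edgeList r s)[(i : ℕ)]? = some (cycEdge r s i) := by
  rw [edgeList, List.getElem?_append_left (by simp)]
  simp

theorem edgeList_crossEdge (i : Fin r) (j : Fin s) :
    (edgeList r s)[r + i * s + j]? = some (crossEdge i j) := by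
  rw [edgeList, List.getElem?_append_right (by simp; omega), List.length_map,
    List.length_finRange, add_assoc, Nat.add_sub_cancel_left, mul_comm,
    getElem?_flatMap_of_length_eq j.isLt _ (by simp)]
  simp

/-- A rational number as two words. -/
def fractionWords (q : ℚ) : List ℕ := [q.num.toNat, q.den]

namespace Instance

variable (I : Instance)

/-- The costs of all edges in the order of the encoding, `a_e` followed by `b_e`. -/
def fractions : List ℚ := (edgeList I.r I.s).flatMap fun e => [I.a e, I.b e]

theorem encode_eq : I.encode = I.r :: I.s :: I.fractions.flatMap fractionWords := by
  simp [encode, fractions, edgeList, edgeWords, fractionWords, List.flatMap_assoc,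
    List.flatMap_append, List.flatMap_map]

theorem nonneg_of_mem_fractions {q : ℚ} (hq : q ∈ I.fractions) : 0 ≤ q := by
  simp only [fractions, List.mem_flatMap, List.mem_cons, List.not_mem_nil, or_false] at hq
  obtain ⟨e, he, rfl | rfl⟩ := hq
  · exact I.a_nonneg e (mem_edgeSet_of_mem_edgeList I.three_le he)
  · exact I.b_nonneg e (mem_edgeSet_of_mem_edgeList I.three_le he)

variable {I} in
theorem getElem?_fractions {m c : ℕ} {e : Sym2 (Vert I.r I.s)} (hc : c < 2)
    (he : (edgeList I.r I.s)[m]? = some e) : I.fractions[2 * m + c]? = [I.a e, I.b e][c]? := by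
  rw [fractions, getElem?_flatMap_of_length_eq hc _ (fun _ _ => rfl), he, Option.bind_some]

variable (n : ℕ)

/-- The words in the input bank of the program, for the accuracy parameter `n`. -/
def input : ℕ → ℕ := RAM.initMem (n :: I.encode) RAM.Bank.input

theorem input_add_three (k : ℕ) :
    I.input n (3 + k) = (I.fractions.flatMap fractionWords)[k]?.getD 0 := by
  rw [input, encode_eq, add_comm, RAM.initMem, if_pos rfl, ← List.getD_eq_getElem?_getD]
  rfl

theorem fractionCount_input : RAM.fractionCount (I.input n) = I.fractions.length := by
  have hlength : I.fractions.length = 2 * (I.r + I.r * I.s) := by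
    simp [fractions, List.length_flatMap, length_edgeList, mul_comm]
  exact hlength.symm

variable {I n} {p : ℕ} {q : ℚ}

theorem num_input (hq : I.fractions[p]? = some q) : RAM.num (I.input n) p = q.num.toNat := by
  rw [RAM.num, input_add_three, ← add_zero (2 * p),
    getElem?_flatMap_of_length_eq two_pos _ (fun _ _ => rfl), hq]
  rfl

theorem den_input (hq : I.fractions[p]? = some q) : RAM.den (I.input n) p = q.den := by
  rw [RAM.den, show 4 + 2 * p = 3 + (2 * p + 1) by omega, input_add_three,
    getElem?_flatMap_of_length_eq one_lt_two _ (fun _ _ => rfl), hq]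
  rfl

variable (I n)

theorem denPos_input : RAM.DenPos (I.input n) := by
  intro p hp
  rw [fractionCount_input] at hp
  rw [den_input (List.getElem?_eq_getElem hp)]
  exact Rat.den_pos _

theorem scale_input : RAM.scale (I.input n) =
    (I.fractions.map fun q => (q.num.toNat + 1) * q.den).prod := by
  rw [RAM.scale, RAM.commonMultiple, fractionCount_input, Finset.prod_range,
    ← Fin.prod_univ_fun_getElem]
  refine Finset.prod_congr rfl fun p _ => ?_
  have hp := List.getElem?_eq_getElem p.isLt
  rw [num_input hp, den_input hp]

end Instance

theorem prod_le_two_pow_wordSize (l : List ℚ) :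
    (l.map fun q => (q.num.toNat + 1) * q.den).prod ≤
      2 ^ RAM.wordSize (l.flatMap fractionWords) := by
  induction l with
  | nil => exact Nat.one_le_two_pow
  | cons q l ih =>
    have hsize (k : ℕ) : k + 1 ≤ 2 ^ (k.size + 1) :=
      (Nat.lt_size_self k).trans_le (Nat.pow_le_pow_right two_pos (Nat.le_succ _))
    have hwords : RAM.wordSize ((q :: l).flatMap fractionWords) =
        (q.num.toNat.size + 1) + (q.den.size + 1) + RAM.wordSize (l.flatMap fractionWords) := by
      simp [RAM.wordSize, fractionWords, add_assoc]
    rw [List.map_cons, List.prod_cons, hwords, pow_add, pow_add]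
    gcongr
    · exact hsize _
    · exact (Nat.le_succ _).trans (hsize _)

/-! ## Costs of tours -/

theorem cast_four_mul_num_mul_div {q : ℚ} (hq : 0 ≤ q) {D : ℕ} (hD : q.den ∣ D) :
    ((4 * q.num.toNat * (D / q.den) : ℕ) : ℚ) = 4 * D * q := by
  have hnum : ((q.num.toNat : ℤ) : ℚ) = q.num := by
    rw [Int.toNat_of_nonneg (Rat.num_nonneg.2 hq)]
  have hden : (q.den : ℚ) ≠ 0 := Nat.cast_ne_zero.2 q.den_ne_zero
  push_cast [Nat.cast_div hD hden] at hnum ⊢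
  rw [hnum]
  nth_rewrite 3 [← Rat.num_div_den q]
  field_simp

namespace Instance

variable {I : Instance} {n c : ℕ}

theorem cast_scaledCost {m : ℕ} {q : ℚ} (hq : I.fractions[2 * m + c]? = some q) :
    (RAM.scaledCost (I.input n) c m : ℚ) = 4 * RAM.scale (I.input n) * q := by
  have hlt : 2 * m + c < RAM.fractionCount (I.input n) := by
    rw [fractionCount_input]
    exact (List.getElem?_eq_some_iff.1 hq).1
  have hdvd := RAM.den_dvd_scale hlt
  rw [den_input hq] at hdvd
  rw [RAM.scaledCost, num_input hq, den_input hq]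
  exact cast_four_mul_num_mul_div (I.nonneg_of_mem_fractions (List.mem_of_getElem? hq)) hdvd

theorem cast_assignCost_entry {π : Fin I.s ↪ Fin I.r} {o : ℕ → ℕ} (h : Represents π o)
    (ho : IsAssignment I.r o) {f : Sym2 (Vert I.r I.s) → ℚ}
    (hf : ∀ m e, (edgeList I.r I.s)[m]? = some e → I.fractions[2 * m + c]? = some (f e)) :
    (RAM.assignCost (RAM.entry (I.input n) c) I.r o : ℚ) =
      4 * RAM.scale (I.input n) * ∑ e ∈ ejectInsert π, f e := by
  rw [sum_ejectInsert I.three_le, RAM.assignCost, Finset.sum_range, Nat.cast_sum, Finset.mul_sum]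
  refine Finset.sum_congr rfl fun i _ => ?_
  have hr : I.input n 1 = I.r := rfl
  have hs : I.input n 2 = I.s := rfl
  rw [RAM.entry, hr, hs]
  split_ifs with hi
  · obtain ⟨j, rfl, hj⟩ := h.exists_eq_of_le ho hi
    rw [segmentEdges_apply, hj, ← val_finRotate, Nat.add_sub_cancel, Nat.cast_add,
      cast_scaledCost (hf _ _ (edgeList_crossEdge _ _)),
      cast_scaledCost (hf _ _ (edgeList_crossEdge _ _))]
    simp [mul_add, -finRotate_apply]
  · rw [segmentEdges_of_ne (h.ne_of_lt (not_le.1 hi)),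
      cast_scaledCost (hf _ _ (edgeList_cycEdge i))]
    simp

theorem cast_value {π : Fin I.s ↪ Fin I.r} {o : ℕ → ℕ} (h : Represents π o)
    (ho : IsAssignment I.r o) :
    ((RAM.costData (I.input n)).value o : ℚ) =
      (4 * RAM.scale (I.input n)) ^ 2 * I.objective (ejectInsert π) := by
  have ha := cast_assignCost_entry (n := n) h ho (f := I.a) fun _ _ he =>
    getElem?_fractions two_pos he
  have hb := cast_assignCost_entry (n := n) h ho (f := I.b) fun _ _ he =>
    getElem?_fractions one_lt_two he
  have hvalue : (RAM.costData (I.input n)).value o =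
    RAM.assignCost (RAM.entry (I.input n) 0) I.r o *
      RAM.assignCost (RAM.entry (I.input n) 1) I.r o := rfl
  rw [hvalue, Nat.cast_mul, ha, hb, objective]
  ring

theorem objective_nonneg {τ : Finset (Sym2 (Vert I.r I.s))} (hτ : τ ∈ tours I.r I.s) :
    0 ≤ I.objective τ := by
  obtain ⟨⟨u, p, -, rfl⟩, -⟩ := hτ
  have hedge {e} (he : e ∈ p.edges.toFinset) : e ∈ (graph I.r I.s).edgeSet :=
    p.edges_subset_edgeSet (List.mem_toFinset.1 he)
  exact mul_nonneg (Finset.sum_nonneg fun e he => I.a_nonneg e (hedge he))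
    (Finset.sum_nonneg fun e he => I.b_nonneg e (hedge he))

end Instance

end MEE

/-! ## Size of the numbers and running time -/

namespace RAM

theorem length_le_wordSize (w : List ℕ) : w.length ≤ wordSize w := by
  refine (List.length_map _).symm.trans_le (List.length_le_sum_of_one_le _ fun k hk => ?_)
  obtain ⟨n, -, rfl⟩ := List.mem_map.1 hk
  exact Nat.le_add_left 1 _

theorem wordSize_cons (n : ℕ) (w : List ℕ) : wordSize (n :: w) = n.size + 1 + wordSize w := by
  simp [wordSize]

theorem size_lt_wordSize {w : List ℕ} {n : ℕ} (h : n ∈ w) : n.size < wordSize w :=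
  List.single_le_sum (fun _ _ => Nat.zero_le _) (n.size + 1) (List.mem_map.2 ⟨n, h, rfl⟩)

theorem bounded_initMem {w : List ℕ} {b : ℕ} (hb : wordSize w ≤ b) : Bounded b (initMem w) := by
  intro x i
  rw [initMem]
  split_ifs
  · obtain hi | hi := lt_or_ge i w.length
    · rw [List.getD_eq_getElem _ _ hi]
      exact Nat.size_le.1 ((size_lt_wordSize (List.getElem_mem hi)).le.trans hb)
    · rw [List.getD_eq_default _ _ hi]
      positivity
  · positivity

theorem sq_lt_two_pow (X : ℕ) : 64 * (X + 1) ^ 2 < 2 ^ (6 * X + 20) :=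
  calc 64 * (X + 1) ^ 2 ≤ 64 * (2 ^ X) ^ 2 := by gcongr; exact Nat.lt_two_pow_self
    _ = 2 ^ (2 * X + 6) := by ring
    _ < 2 ^ (6 * X + 20) := Nat.pow_lt_pow_right one_lt_two (by omega)

theorem costBound_lt {w : ℕ → ℕ} {X : ℕ} (hr : w 1 ≤ X) (hscale : scale w ≤ 2 ^ X) :
    costBound w < 2 ^ (3 * X + 3) :=
  calc costBound w ≤ 8 * w 1 * (2 ^ X * 2 ^ X) := by rw [costBound]; gcongr
    _ < 8 * 2 ^ X * (2 ^ X * 2 ^ X) := by gcongr; exact hr.trans_lt Nat.lt_two_pow_self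
    _ = 2 ^ (3 * X + 3) := by ring

theorem AssignmentData.fitsWord_of_le {D : AssignmentData} {S X : ℕ} (hr : D.r ≤ X) (hn : D.n ≤ X)
    (hS : S < 2 ^ (3 * X + 3)) : D.FitsWord S (6 * X + 20) := by
  have hsq := sq_lt_two_pow X
  have hvalue : 2 * (S * S) + 1 < 2 ^ (6 * X + 20) :=
    calc 2 * (S * S) + 1 ≤ 2 * (2 ^ (3 * X + 3) * 2 ^ (3 * X + 3)) + 2 ^ (6 * X + 7) := by
          gcongr
          exact Nat.one_le_two_pow
      _ = 2 ^ (6 * X + 8) := by ring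
      _ < 2 ^ (6 * X + 20) := Nat.pow_lt_pow_right one_lt_two (by omega)
  refine ⟨?_, ?_, ?_, hvalue⟩
  · nlinarith
  · calc 4 * (12 * D.r * D.n) + 2 ≤ 4 * (12 * X * X) + 2 := by gcongr
      _ ≤ 64 * (X + 1) ^ 2 := by nlinarith
      _ < 2 ^ (6 * X + 20) := hsq
  · have := Nat.le_mul_self S
    omega

theorem guessSteps_le {r n X : ℕ} (hX : 1 ≤ X) (hr : r ≤ X) (hn : n ≤ X) :
    guessSteps r n ≤ 1000 * X ^ 4 := by
  have hpow {k : ℕ} (hk : k ≤ 4) : X ^ k ≤ X ^ 4 := Nat.pow_le_pow_right hX hk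
  have h₀ := hpow (k := 0) (by norm_num)
  have h₁ := hpow (k := 1) (by norm_num)
  have h₂ := hpow (k := 2) (by norm_num)
  have h₃ := hpow (k := 3) (by norm_num)
  calc guessSteps r n ≤ guessSteps X X := by unfold guessSteps auctionSteps; gcongr
    _ ≤ 1000 * X ^ 4 := by unfold guessSteps auctionSteps; linarith

theorem schemeSteps_le {r s n L X : ℕ} (hX : 1 ≤ X) (hr : r ≤ X) (hs : s ≤ X) (hn : n ≤ X)
    (hL : L ≤ 6 * X) : schemeSteps r s n L ≤ 1000000 * X ^ 8 := by
  have hpow {k : ℕ} (hk : k ≤ 8) : X ^ k ≤ X ^ 8 := Nat.pow_le_pow_right hX hk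
  have h₀ := hpow (k := 0) (by norm_num)
  have h₁ := hpow (k := 1) (by norm_num)
  have h₂ := hpow (k := 2) (by norm_num)
  have h₄ := hpow (k := 4) (by norm_num)
  have hguess := guessSteps_le hX hr hn
  calc schemeSteps r s n L ≤ 3 * (2 * (X + X * X)) + 3 + (6 * (X * X) + 2 + (1 + (1 +
        (4 * X * (6 * X) * (4 * X * (6 * X) * (1000 * X ^ 4 + 2) + 4) + 2)))) := by
          unfold schemeSteps; gcongr
    _ ≤ 1000000 * X ^ 8 := by linarith

end RAM

/-! ## The approximation guarantee -/

namespace MEE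

theorem le_one_add_mul_of_ceil_mul_le {ε x y : ℝ} (hε : 0 < ε) (hy : 0 ≤ y)
    (h : ⌈1 / ε⌉₊ * x ≤ (⌈1 / ε⌉₊ + 1) * y) : x ≤ (1 + ε) * y := by
  have hpos : (0 : ℝ) < ⌈1 / ε⌉₊ := Nat.cast_pos.2 (Nat.ceil_pos.2 (one_div_pos.2 hε))
  have hceil : 1 ≤ ⌈1 / ε⌉₊ * ε := (div_le_iff₀ hε).1 (Nat.le_ceil _)
  refine le_of_mul_le_mul_left ?_ hpos
  calc ⌈1 / ε⌉₊ * x ≤ (⌈1 / ε⌉₊ + 1) * y := h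
    _ ≤ (⌈1 / ε⌉₊ + ⌈1 / ε⌉₊ * ε) * y := by gcongr
    _ = ⌈1 / ε⌉₊ * ((1 + ε) * y) := by ring

namespace Instance

variable (I : Instance) {n : ℕ}

theorem r_le_wordSize : I.r ≤ RAM.wordSize I.encode := by
  have hlength : I.encode.length = I.r * 4 + I.r * (I.s * 4) + 2 := by
    simp [encode, edgeWords, List.length_flatMap]
  have hword := RAM.length_le_wordSize I.encode
  omega

theorem scale_input_le : RAM.scale (I.input n) ≤ 2 ^ RAM.wordSize I.encode := by
  rw [scale_input]
  refine (prod_le_two_pow_wordSize _).trans (Nat.pow_le_pow_right two_pos ?_)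
  rw [encode_eq, RAM.wordSize_cons, RAM.wordSize_cons]
  omega

variable {I} in
theorem exists_tour_of_isAssignment {o : ℕ → ℕ} (ho : IsAssignment I.r o)
    (hopt : ∀ σ, IsAssignment I.r σ → n * (RAM.costData (I.input n)).value o ≤
      (n + 1) * (RAM.costData (I.input n)).value σ) :
    ∃ S : tours I.r I.s, Describes (RAM.tourList I.r I.s o I.r) S.1 ∧
      ∀ S' : tours I.r I.s, (n : ℚ) * I.objective S.1 ≤ (n + 1) * I.objective S'.1 := by
  obtain ⟨π, hπ⟩ := exists_represents I.s_le_r ho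
  refine ⟨⟨ejectInsert π, ejectInsert_mem_tours I.three_le π⟩,
    hπ.tourList_eq ho ▸ describes_ejectInsert I.three_le π, ?_⟩
  rintro ⟨τ, -, ρ, rfl⟩
  obtain ⟨σ, hσ, hρ⟩ := exists_isAssignment_represents I.s_le_r ρ
  have hle : (n : ℚ) * (RAM.costData (I.input n)).value o ≤
      (n + 1) * (RAM.costData (I.input n)).value σ := by exact_mod_cast hopt σ hσ
  rw [cast_value hπ ho, cast_value hρ hσ, mul_left_comm, mul_left_comm (n + 1 : ℚ)] at hle
  have hscale : (0 : ℚ) < RAM.scale (I.input n) := Nat.cast_pos.2 (RAM.scale_pos (I.denPos_input n))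
  exact le_of_mul_le_mul_left hle (by positivity)

theorem scheme_runs {X : ℕ} (hn : 0 < n) (hX : RAM.wordSize I.encode + n ≤ X) :
    RAM.Runs (6 * X + 20) RAM.scheme (RAM.initMem (n :: I.encode))
      (RAM.schemeSteps I.r I.s n (3 * X + 3)) fun M =>
        ∃ S : tours I.r I.s, Describes (RAM.output M) S.1 ∧
          ∀ S' : tours I.r I.s, (n : ℚ) * I.objective S.1 ≤ (n + 1) * I.objective S'.1 := by
  have hr := I.three_le
  have hs := I.s_le_r
  have hrX : I.r ≤ X := I.r_le_wordSize.trans (by omega)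
  have hsq := RAM.sq_lt_two_pow X
  have hcost : RAM.costBound (I.input n) < 2 ^ (3 * X + 3) := RAM.costBound_lt hrX
    (I.scale_input_le.trans (Nat.pow_le_pow_right two_pos (by omega)))
  have hcount : 2 * (I.r + I.r * I.s) < 2 ^ (6 * X + 20) := by nlinarith
  have hindex : I.r * I.r + I.r < 2 ^ (6 * X + 20) := by nlinarith
  have hword : (RAM.costData (I.input n)).FitsWord (RAM.costBound (I.input n)) (6 * X + 20) :=
    RAM.AssignmentData.fitsWord_of_le hrX (show n ≤ X by omega) hcost
  refine (RAM.scheme_runs (w := I.input n) rfl hn (show 0 < I.r by omega) (I.denPos_input n) hcost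
    hcount hindex hword).mono le_rfl fun M ⟨o, ho, hout, hopt⟩ => ?_
  obtain ⟨S, hS, hS'⟩ := exists_tour_of_isAssignment ho hopt
  exact ⟨S, hout ▸ hS, hS'⟩

theorem exists_exec_scheme (hn : 0 < n) :
    ∃ t M, RAM.Exec RAM.scheme (RAM.initMem (n :: I.encode)) t M ∧
      t ≤ 27000000 * RAM.scheme.weight * (RAM.wordSize I.encode + n) ^ 9 ∧
      ∃ S : tours I.r I.s, Describes (RAM.output M) S.1 ∧
        ∀ S' : tours I.r I.s, (n : ℚ) * I.objective S.1 ≤ (n + 1) * I.objective S'.1 := by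
  set X := RAM.wordSize I.encode + n with hX
  have hrX : I.r ≤ X := I.r_le_wordSize.trans (by omega)
  have hsize : n.size ≤ n := Nat.size_le.2 Nat.lt_two_pow_self
  have hbounded : RAM.Bounded (6 * X + 20) (RAM.initMem (n :: I.encode)) :=
    RAM.bounded_initMem (by rw [RAM.wordSize_cons]; omega)
  obtain ⟨t, M, hexec, ht, -, hsolution⟩ := I.scheme_runs hn hX.ge hbounded
  have hsteps : RAM.schemeSteps I.r I.s n (3 * X + 3) ≤ 1000000 * X ^ 8 :=
    RAM.schemeSteps_le (by omega) hrX (I.s_le_r.trans hrX) (by omega) (by omega)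
  have hword : 6 * X + 20 + 1 ≤ 27 * X := by omega
  refine ⟨t, M, hexec, ?_, hsolution⟩
  calc t ≤ RAM.schemeSteps I.r I.s n (3 * X + 3) * (RAM.scheme.weight * (6 * X + 20 + 1)) := ht
    _ ≤ 1000000 * X ^ 8 * (RAM.scheme.weight * (27 * X)) := by gcongr
    _ = 27000000 * RAM.scheme.weight * X ^ 9 := by ring

theorem wordSize_add_ceil_le {ε : ℝ} (hε : 0 < ε) :
    (RAM.wordSize I.encode + ⌈1 / ε⌉₊ : ℝ) ≤ 2 * (RAM.wordSize I.encode + 1 / ε) := by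
  have hword : (1 : ℝ) ≤ RAM.wordSize I.encode :=
    Nat.one_le_cast.2 (le_trans (by norm_num) (I.three_le.trans I.r_le_wordSize))
  have hε' : 0 < 1 / ε := one_div_pos.2 hε
  linarith [Nat.ceil_lt_add_one hε'.le]

end Instance

end MEE

theorem mainTheorem10 : qtspRankOneMEE.AdmitsFPTAS := by
  refine ⟨RAM.scheme, 27000000 * RAM.scheme.weight * 2 ^ 9, 9, fun (I : MEE.Instance) ε hε => ?_⟩
  obtain ⟨t, M, hexec, ht, S, hS, hopt⟩ :=
    I.exists_exec_scheme (Nat.ceil_pos.2 (one_div_pos.2 hε))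
  refine ⟨t, M, hexec, ?_, S, hS, fun S' => ?_⟩
  · calc (t : ℝ) ≤ 27000000 * RAM.scheme.weight * (RAM.wordSize I.encode + ⌈1 / ε⌉₊) ^ 9 := by
          exact_mod_cast ht
      _ ≤ 27000000 * RAM.scheme.weight * (2 * (RAM.wordSize I.encode + 1 / ε)) ^ 9 := by
          gcongr
          exact I.wordSize_add_ceil_le hε
      _ = (27000000 * RAM.scheme.weight * 2 ^ 9 : ℕ) * (RAM.wordSize I.encode + 1 / ε) ^ 9 := by
          push_cast
          ring
  · exact MEE.le_one_add_mul_of_ceil_mul_le hε (Rat.cast_nonneg.2 (I.objective_nonneg S'.2))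
      (by exact_mod_cast hopt S')
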